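/- Let $k$ be a field of characteristic zero and let $C$ be a Hopf algebra over $k$. Assume that $C$ is connected (its coradical, the sum of its simple subcoalgebras, is one-dimensional), that the space of primitive elements of $C$ is two-dimensional ($C$ is primitively-thin), and that $C$ has Gelfand–Kirillov dimension $3$. Let $x,y,z$ be any elements that generate $C$ as an algebra, such that $x$ and $y$ are primitive and $$\Delta(z)=1\otimes z+x\otimes y-y\otimes x+z\otimes 1 .$$ Let $C^+=\ker\epsilon$, let $\delta\colon C^+\to C^+\otimes C^+$, $\delta(c)=\Delta(c)-(1\otimes c+c\otimes 1)$, and let $\Omega C$ be the cobar construction of $C$: the tensor algebra of $C^+$, with $C^+$ in degree one, whose differential $\partial$ is the graded derivation extending $\delta$. Then the elements $$u=z\otimes x-x\otimes z+xy\otimes x+x\otimes xy,\qquad t=y\otimes z-z\otimes y+xy\otimes y+y\otimes xy$$ of $C^+\otimes C^+$ are $2$-cocycles of $\Omega C$, their classes span $H^2(\Omega C)$, and $\dim_k H^2(\Omega C)=2$. -/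

import Mathlib

open scoped TensorProduct

noncomputable section

/-! ### Growth of algebras -/

/-- The Gelfand–Kirillov dimension of a `k`-algebra `A`: the supremum, over all finite-dimensional
subspaces `V`, of `limsup_n log (dim (k + V + ⋯ + V ^ n)) / log n`.
Note that `(k + V) ^ n = k + V + ⋯ + V ^ n`. -/
def gkDim (k A : Type*) [Field k] [Ring A] [Algebra k A] : EReal :=
  ⨆ (V : Submodule k A) (_ : FiniteDimensional k V),
    Filter.limsup
      (fun n : ℕ =>
        ((Real.log (Module.finrank k ↥((1 ⊔ V) ^ n)) / Real.log n : ℝ) : EReal))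
      Filter.atTop

/-! ### Connected coalgebras and primitive elements -/

section Coalgebra

variable (k : Type*) {C : Type*} [Field k] [AddCommGroup C] [Module k C] [Coalgebra k C]

/-- A subspace `D` is a subcoalgebra when `Δ(D)` lies in (the image of) `D ⊗ D`. -/
def IsSubcoalgebra (D : Submodule k C) : Prop :=
  ∀ d ∈ D, Coalgebra.comul (R := k) d ∈
    LinearMap.range (TensorProduct.map D.subtype D.subtype)

/-- A simple subcoalgebra: nonzero, with no subcoalgebras other than `0` and itself. -/
def IsSimpleSubcoalgebra (D : Submodule k C) : Prop :=
  IsSubcoalgebra k D ∧ D ≠ ⊥ ∧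
    ∀ E : Submodule k C, IsSubcoalgebra k E → E ≤ D → E = ⊥ ∨ E = D

variable (C) in
/-- The coradical: the sum of all simple subcoalgebras. -/
def coradical : Submodule k C :=
  sSup {D : Submodule k C | IsSimpleSubcoalgebra k D}

variable (C) in
/-- A coalgebra is connected when its coradical is one-dimensional. -/
def IsConnectedCoalgebra : Prop :=
  Module.finrank k (coradical k C) = 1

end Coalgebra

section Hopf

variable (k : Type*) {C : Type*} [Field k] [Ring C] [HopfAlgebra k C]

/-- `x` is primitive when `Δ(x) = x ⊗ 1 + 1 ⊗ x`. -/
def IsPrimitiveElt (x : C) : Prop :=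
  Coalgebra.comul (R := k) x = x ⊗ₜ[k] 1 + 1 ⊗ₜ[k] x

variable (C) in
/-- The space `P(C)` of primitive elements. -/
def primitiveSubmodule : Submodule k C where
  carrier := {x | IsPrimitiveElt k x}
  add_mem' {a b} ha hb := by
    simp only [Set.mem_ofPred_eq, IsPrimitiveElt] at ha hb ⊢
    rw [map_add, ha, hb, TensorProduct.add_tmul, TensorProduct.tmul_add]
    abel
  zero_mem' := by simp [IsPrimitiveElt]
  smul_mem' c a ha := by
    simp only [Set.mem_ofPred_eq, IsPrimitiveElt] at ha ⊢
    rw [map_smul, ha, smul_add, TensorProduct.smul_tmul', TensorProduct.tmul_smul]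

variable (C) in
/-- A primitively-thin Hopf algebra: connected, with two-dimensional space of primitives. -/
structure IsPrimitivelyThin : Prop where
  connected : IsConnectedCoalgebra k C
  finrank_primitive : Module.finrank k (primitiveSubmodule k C) = 2

/-! ### The cobar construction -/

variable (C) in
/-- `C⁺`, the kernel of the counit. -/
def augKer : Submodule k C :=
  LinearMap.ker (Coalgebra.counit (R := k) (A := C))

/-- The projection `c ↦ c - ε(c) 1` of `C = k 1 ⊕ C⁺` onto `C⁺`. -/
def augProj : C →ₗ[k] augKer k C :=
  LinearMap.codRestrict (augKer k C)
    (LinearMap.id - (Algebra.linearMap k C).comp (Coalgebra.counit (R := k) (A := C)))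
    (fun c => by simp [augKer])

theorem augProj_coe (c : C) :
    (augProj k c : C) = c - algebraMap k C (Coalgebra.counit (R := k) c) := rfl

theorem augProj_of_mem {c : C} (hc : c ∈ augKer k C) : augProj k c = ⟨c, hc⟩ := by
  have h : Coalgebra.counit (R := k) c = 0 := hc
  ext
  simp [augProj_coe, h]

variable (C) in
/-- The reduced comultiplication `δ : C⁺ → C⁺ ⊗ C⁺`, the `C⁺ ⊗ C⁺` component of `Δ`; see
`reducedComul_eq` for the formula `δ(x) = Δ(x) - (1 ⊗ x + x ⊗ 1)`. -/
def reducedComul : augKer k C →ₗ[k] augKer k C ⊗[k] augKer k C :=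
  (TensorProduct.map (augProj k) (augProj k)).comp
    ((Coalgebra.comul (R := k) (A := C)).comp (augKer k C).subtype)

theorem reducedComul_eq (x : augKer k C) :
    TensorProduct.map (augKer k C).subtype (augKer k C).subtype (reducedComul k C x) =
      Coalgebra.comul (R := k) (x : C) - (1 ⊗ₜ[k] (x : C) + (x : C) ⊗ₜ[k] 1) := by
  obtain ⟨x, hx⟩ := x
  have hx0 : Coalgebra.counit (R := k) x = 0 := hx
  let R := Coalgebra.Repr.arbitrary k x
  have h1 : ∑ i ∈ R.index,
      (1 : C) ⊗ₜ[k] (algebraMap k C (Coalgebra.counit (R := k) (R.left i)) * R.right i)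
        = 1 ⊗ₜ[k] x := by
    rw [← TensorProduct.tmul_sum]
    congr 1
    simpa [Algebra.smul_def] using Coalgebra.sum_counit_smul R
  have h2 : ∑ i ∈ R.index,
      (R.left i * algebraMap k C (Coalgebra.counit (R := k) (R.right i))) ⊗ₜ[k] (1 : C)
        = x ⊗ₜ[k] 1 := by
    rw [← TensorProduct.sum_tmul]
    congr 1
    have h := congrArg (TensorProduct.rid k C) (Coalgebra.sum_tmul_counit_eq R)
    rw [map_sum, TensorProduct.rid_tmul, one_smul] at h
    refine Eq.trans ?_ h
    refine Finset.sum_congr rfl fun i _ => ?_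
    rw [TensorProduct.rid_tmul, Algebra.smul_def, Algebra.commutes]
  have h3 : ∑ i ∈ R.index,
      (algebraMap k C (Coalgebra.counit (R := k) (R.left i) *
        Coalgebra.counit (R := k) (R.right i))) ⊗ₜ[k] (1 : C) = 0 := by
    rw [← TensorProduct.sum_tmul, ← map_sum]
    have := congrArg (Coalgebra.counit (R := k)) (Coalgebra.sum_counit_smul R)
    simp only [map_sum, map_smul, smul_eq_mul, hx0] at this
    rw [this]; simp
  have hd : Coalgebra.comul (R := k) x = ∑ i ∈ R.index, R.left i ⊗ₜ[k] R.right i := R.eq.symm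
  have key : ∀ a b : C,
      (a - algebraMap k C (Coalgebra.counit (R := k) a)) ⊗ₜ[k]
        (b - algebraMap k C (Coalgebra.counit (R := k) b)) =
      a ⊗ₜ[k] b - (1 : C) ⊗ₜ[k] (algebraMap k C (Coalgebra.counit (R := k) a) * b)
        - (a * algebraMap k C (Coalgebra.counit (R := k) b)) ⊗ₜ[k] (1 : C)
        + (algebraMap k C (Coalgebra.counit (R := k) a * Coalgebra.counit (R := k) b))
          ⊗ₜ[k] (1 : C) := by
    intro a b
    rw [← Algebra.commutes (Coalgebra.counit (R := k) b) a]
    simp only [TensorProduct.sub_tmul, TensorProduct.tmul_sub, Algebra.algebraMap_eq_smul_one,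
      smul_mul_assoc, one_mul, TensorProduct.tmul_smul, TensorProduct.smul_tmul', mul_smul]
    rw [smul_sub, TensorProduct.smul_tmul', TensorProduct.smul_tmul', smul_comm]
    abel
  simp only [reducedComul, LinearMap.comp_apply, Submodule.subtype_apply, hd, map_sum,
    TensorProduct.map_tmul, augProj_coe, key, Finset.sum_add_distrib, Finset.sum_sub_distrib,
    h1, h2, h3]
  abel

variable (C) in
/-- The underlying algebra of the cobar construction `ΩC`: the tensor algebra of `C⁺`. -/
abbrev Cobar : Type _ := TensorAlgebra k (augKer k C)

variable (C) in
/-- The component `(C⁺)^{⊗ n}` of `ΩC`, of cohomological degree `n`. -/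
def cobarDegree (n : ℕ) : Submodule k (Cobar k C) :=
  LinearMap.range (TensorAlgebra.ι k : augKer k C →ₗ[k] Cobar k C) ^ n

/-- The element `[c]` of degree one of `ΩC` given by `c ∈ C`; it is `c` itself, placed in
degree one, when `c ∈ C⁺`, and in general it is the component of `c` in `C⁺`. -/
def cobarOne : C →ₗ[k] Cobar k C :=
  (TensorAlgebra.ι k).comp (augProj k)

theorem cobarOne_of_mem {c : C} (hc : c ∈ augKer k C) :
    cobarOne k c = TensorAlgebra.ι k (⟨c, hc⟩ : augKer k C) := by
  simp [cobarOne, augProj_of_mem k hc]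

variable (C) in
/-- `δ`, followed by the identification of `C⁺ ⊗ C⁺` with the degree two component of `ΩC`. -/
def cobarDelta : augKer k C →ₗ[k] Cobar k C :=
  (LinearMap.mul' k (Cobar k C)).comp
    ((TensorProduct.map (TensorAlgebra.ι k) (TensorAlgebra.ι k)).comp (reducedComul k C))

variable (C) in
/-- The algebra homomorphism `a ↦ !![(-1)^|a| a, ∂ a; 0, a]`. Multiplicativity of this map says
exactly that `∂(a b) = ∂(a) b + (-1)^|a| a ∂(b)`. -/
def cobarMatrix : Cobar k C →ₐ[k] Matrix (Fin 2) (Fin 2) (Cobar k C) :=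
  TensorAlgebra.lift k
    { toFun := fun v =>
        !![-TensorAlgebra.ι k v, cobarDelta k C v; 0, TensorAlgebra.ι k v]
      map_add' := fun v w => by
        ext i j; fin_cases i <;> fin_cases j <;> simp [add_comm]
      map_smul' := fun c v => by
        ext i j; fin_cases i <;> fin_cases j <;> simp }

variable (C) in
/-- The differential `∂` of `ΩC`: the graded derivation of the tensor algebra extending `δ`
(see `cobarDifferential_ι` and `cobarDifferential_mul`). -/
def cobarDifferential : Cobar k C →ₗ[k] Cobar k C where
  toFun a := cobarMatrix k C a 0 1
  map_add' a b := by simp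
  map_smul' c a := by simp

theorem cobarDifferential_ι (v : augKer k C) :
    cobarDifferential k C (TensorAlgebra.ι k v) = cobarDelta k C v := by
  simp [cobarDifferential, cobarMatrix]

theorem cobarMatrix_lower (a : Cobar k C) :
    cobarMatrix k C a 1 0 = 0 ∧ cobarMatrix k C a 1 1 = a := by
  induction a using TensorAlgebra.induction with
  | algebraMap r => simp [Matrix.algebraMap_matrix_apply]
  | ι v => simp [cobarMatrix]
  | mul a b ha hb => simp [Matrix.mul_apply, ha, hb]
  | add a b ha hb => simp [ha, hb]

theorem cobarMatrix_upper {n : ℕ} {a : Cobar k C} (ha : a ∈ cobarDegree k C n) :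
    cobarMatrix k C a 0 0 = (-1) ^ n * a := by
  induction ha using Submodule.pow_induction_on_left' with
  | algebraMap r => simp [Matrix.algebraMap_matrix_apply]
  | add x y i _ _ hx hy => simp [hx, hy, mul_add]
  | mem_mul m hm i x _ hx =>
    obtain ⟨v, rfl⟩ := hm
    have h0 : cobarMatrix k C (TensorAlgebra.ι k v) 0 0 = -TensorAlgebra.ι k v := by
      simp [cobarMatrix]
    have hc : (-1 : Cobar k C) ^ i * TensorAlgebra.ι k v =
        TensorAlgebra.ι k v * (-1) ^ i :=
      ((Commute.neg_one_left (TensorAlgebra.ι k v)).pow_left i)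
    rw [map_mul, Matrix.mul_apply, Fin.sum_univ_two, hx, h0, (cobarMatrix_lower k x).1, mul_zero,
      add_zero, pow_succ', neg_mul, neg_mul, one_mul, neg_mul, ← mul_assoc, ← mul_assoc, hc]

/-- The graded Leibniz rule. -/
theorem cobarDifferential_mul {n : ℕ} {a : Cobar k C} (ha : a ∈ cobarDegree k C n)
    (b : Cobar k C) :
    cobarDifferential k C (a * b) =
      cobarDifferential k C a * b + (-1) ^ n * a * cobarDifferential k C b := by
  change cobarMatrix k C (a * b) 0 1 =
    cobarMatrix k C a 0 1 * b + (-1) ^ n * a * cobarMatrix k C b 0 1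
  rw [map_mul, Matrix.mul_apply, Fin.sum_univ_two, (cobarMatrix_lower k b).2,
    cobarMatrix_upper k ha, add_comm]

theorem cobarDifferential_cobarOne (c : C) :
    cobarDifferential k C (cobarOne k c) =
      (LinearMap.mul' k (Cobar k C)).comp (TensorProduct.map (cobarOne k) (cobarOne k))
        (Coalgebra.comul (R := k) c) := by
  have h1 : augProj k (1 : C) = 0 := by ext; simp [augProj_coe]
  have hc : cobarOne k c = TensorAlgebra.ι k (augProj k c) := rfl
  rw [hc, cobarDifferential_ι]
  simp only [cobarDelta, reducedComul, LinearMap.comp_apply, Submodule.subtype_apply,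
    augProj_coe, map_sub, Algebra.algebraMap_eq_smul_one, map_smul, Bialgebra.comul_one,
    Algebra.TensorProduct.one_def, TensorProduct.map_tmul, h1, TensorProduct.zero_tmul,
    smul_zero, map_zero, sub_zero]
  rw [← LinearMap.comp_apply (TensorProduct.map _ _) (TensorProduct.map _ _),
    ← TensorProduct.map_comp]
  rfl

theorem cobarOne_mem (c : C) : cobarOne k c ∈ cobarDegree k C 1 := by
  rw [cobarDegree, pow_one]
  exact ⟨_, rfl⟩

theorem cobarOne_mul_cobarOne_mem (a b : C) :
    cobarOne k a * cobarOne k b ∈ cobarDegree k C 2 := by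
  rw [cobarDegree, pow_two]
  exact Submodule.mul_mem_mul ⟨_, rfl⟩ ⟨_, rfl⟩

/-- `∂ ∘ ∂ = 0`, so that coboundaries are cocycles. -/
theorem cobarDifferential_sq (a : Cobar k C) :
    cobarDifferential k C (cobarDifferential k C a) = 0 := by
  let ℓ : C →ₗ[k] Cobar k C := cobarOne k
  have hgen : ∀ c : C, cobarDifferential k C (cobarDifferential k C (cobarOne k c)) = 0 := by
    intro c
    let R := Coalgebra.Repr.arbitrary k c
    let a₁ := fun i : C × C => Coalgebra.Repr.arbitrary k (R.left i)
    let a₂ := fun i : C × C => Coalgebra.Repr.arbitrary k (R.right i)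
    have hd : ∀ (e : C) (S : Coalgebra.Repr k e (C × C)),
        cobarDifferential k C (cobarOne k e) = ∑ i ∈ S.index, ℓ (S.left i) * ℓ (S.right i) := by
      intro e S
      rw [cobarDifferential_cobarOne, ← S.eq]
      simp [ℓ]
    have h := congrArg ((LinearMap.mul' k (Cobar k C)).comp
      (TensorProduct.map LinearMap.id (LinearMap.mul' k (Cobar k C))))
      (Coalgebra.sum_map_tmul_tmul_eq (repr := R) ℓ ℓ ℓ c (a₁ := a₁) (a₂ := a₂))
    simp only [map_sum, LinearMap.comp_apply, TensorProduct.map_tmul, LinearMap.mul'_apply,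
      LinearMap.id_apply] at h
    rw [hd c R, map_sum]
    have : ∀ i ∈ R.index, cobarDifferential k C (ℓ (R.left i) * ℓ (R.right i)) =
        ∑ j ∈ (a₁ i).index, ℓ ((a₁ i).left j) * (ℓ ((a₁ i).right j) * ℓ (R.right i)) -
        ∑ j ∈ (a₂ i).index, ℓ (R.left i) * (ℓ ((a₂ i).left j) * ℓ ((a₂ i).right j)) := by
      intro i _
      rw [cobarDifferential_mul k (cobarOne_mem k (R.left i)), hd _ (a₁ i), hd _ (a₂ i),
        Finset.sum_mul, Finset.mul_sum, sub_eq_add_neg, ← Finset.sum_neg_distrib]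
      simp [mul_assoc, ℓ]
    rw [Finset.sum_congr rfl this, Finset.sum_sub_distrib, sub_eq_zero]
    exact h.symm
  suffices H : ∀ b : Cobar k C, cobarDifferential k C (cobarDifferential k C b) = 0 →
      cobarDifferential k C (cobarDifferential k C (a * b)) = 0 by
    have h1 : cobarDifferential k C 1 = 0 := by simp [cobarDifferential]
    simpa [h1] using H 1
  induction a using TensorAlgebra.induction with
  | algebraMap r => intro b hb; simp [Algebra.algebraMap_eq_smul_one, hb]
  | ι v =>
    intro b hb
    have hv : TensorAlgebra.ι k v = cobarOne k (v : C) := by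
      rw [cobarOne_of_mem k v.2]
    have hmem : cobarDifferential k C (cobarOne k (v : C)) ∈ cobarDegree k C 2 := by
      rw [cobarDifferential_cobarOne, ← (Coalgebra.Repr.arbitrary k (v : C)).eq, map_sum]
      refine Submodule.sum_mem _ fun i _ => ?_
      exact cobarOne_mul_cobarOne_mem k _ _
    rw [hv, cobarDifferential_mul k (cobarOne_mem k _), map_add, cobarDifferential_mul k hmem,
      hgen, pow_one, neg_one_mul, neg_mul, map_neg (cobarDifferential k C),
      cobarDifferential_mul k (cobarOne_mem k _), hb]
    simp
  | mul a a' ha ha' => intro b hb; rw [mul_assoc]; exact ha _ (ha' _ hb)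
  | add a a' ha ha' => intro b hb; rw [add_mul, map_add, map_add, ha b hb, ha' b hb, add_zero]

variable (C) in
/-- The cocycles of degree `n` of `ΩC`. -/
def cobarCocycles (n : ℕ) : Submodule k (Cobar k C) :=
  cobarDegree k C n ⊓ LinearMap.ker (cobarDifferential k C)

variable (C) in
/-- The coboundaries of degree `n` of `ΩC`. -/
def cobarCoboundaries : ℕ → Submodule k (Cobar k C)
  | 0 => ⊥
  | n + 1 => (cobarDegree k C n).map (cobarDifferential k C)

variable (C) in
/-- The `n`-th coalgebra cohomology `Hⁿ(ΩC)`: cocycles modulo coboundaries. -/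
abbrev CobarCohomology (n : ℕ) : Type _ :=
  ↥(cobarCocycles k C n) ⧸ (cobarCoboundaries k C n).submoduleOf (cobarCocycles k C n)

/-- The cohomology class of a cocycle. -/
def cobarClass {n : ℕ} (a : Cobar k C) (ha : a ∈ cobarCocycles k C n) :
    CobarCohomology k C n :=
  Submodule.Quotient.mk ⟨a, ha⟩

/-- `u = z ⊗ x - x ⊗ z + xy ⊗ x + x ⊗ xy`, in `(C⁺)^{⊗ 2}`. -/
def cobarU (x y z : C) : Cobar k C :=
  cobarOne k z * cobarOne k x - cobarOne k x * cobarOne k z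
    + cobarOne k (x * y) * cobarOne k x + cobarOne k x * cobarOne k (x * y)

/-- `t = y ⊗ z - z ⊗ y + xy ⊗ y + y ⊗ xy`, in `(C⁺)^{⊗ 2}`. -/
def cobarT (x y z : C) : Cobar k C :=
  cobarOne k y * cobarOne k z - cobarOne k z * cobarOne k y
    + cobarOne k (x * y) * cobarOne k y + cobarOne k y * cobarOne k (x * y)

end Hopf

end

/-!
Give `x` and `y` weight one and `z` weight two. Since `C` is primitively thin of Gelfand–Kirillov
dimension greater than two, the commutators of `x`, `y` and `z` have lower weight than expected, so
`C` is filtered by weight with a commutative associated graded algebra, on which the operators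
`c ↦ f(c₂) c₁` with `f(1) = 0` act as derivations. For `ξ` and `η` dual to `x` and `y` these satisfy
Euler's identity: on the part of weight `n`, the operator `x ξ + y η + z ⁅ξ, η⁆` is multiplication
by `n`. In characteristic zero this provides antiderivatives: given `α` and `β` satisfying the
integrability condition, there is `c` with `ξ c = α` and `η c = β` modulo lower weight.

A two-cocycle of weight zero vanishes, weight being measured on its slices by `ξ` and `η`, the
contractions of the right tensor factor. Subtracting the coboundary of a common antiderivative of
the two slices lowers the weight; in weight two the integrability condition is obstructed by two
scalars, which vanish on coboundaries and for which `u` and `t` are dual up to sign and scale.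
-/

noncomputable section

namespace ThinHopf

section WeightFiltration

variable (k : Type*) {A B M ι : Type*} [CommSemiring k] [Semiring A] [Algebra k A]
  [Semiring B] [Algebra k B]

/-- The filtration of an algebra by weight, where the generator `g i` has weight `ω i`: the `n`-th
step is spanned by the words in the generators of total weight at most `n`. -/
def weightFil [AddMonoid M] [LE M] (g : ι → A) (ω : ι → M) (n : M) : Submodule k A :=
  Submodule.span k {c | ∃ l : List ι, (l.map ω).sum ≤ n ∧ (l.map g).prod = c}

variable {k}

theorem weightFil_le_iff [AddMonoid M] [LE M] {g : ι → A} {ω : ι → M} {n : M}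
    {p : Submodule k A} :
    weightFil k g ω n ≤ p ↔ ∀ l : List ι, (l.map ω).sum ≤ n → (l.map g).prod ∈ p := by
  simp only [weightFil, Submodule.span_le, Set.subset_def, Set.mem_ofPred_eq, SetLike.mem_coe,
    forall_exists_index, and_imp]
  exact ⟨fun h l hl => h _ l hl rfl, fun h _ l hl hc => hc ▸ h l hl⟩

theorem monotone_weightFil [AddMonoid M] [Preorder M] (g : ι → A) (ω : ι → M) :
    Monotone (weightFil k g ω) :=
  fun _ _ h => Submodule.span_mono fun _ ⟨l, hl, hc⟩ => ⟨l, hl.trans h, hc⟩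

theorem prod_mem_weightFil [AddMonoid M] [Preorder M] (g : ι → A) (ω : ι → M) (l : List ι) :
    (l.map g).prod ∈ weightFil k g ω (l.map ω).sum :=
  Submodule.subset_span ⟨l, le_rfl, rfl⟩

theorem generator_mem_weightFil [AddMonoid M] [Preorder M] (g : ι → A) (ω : ι → M) (i : ι) :
    g i ∈ weightFil k g ω (ω i) := by
  simpa using prod_mem_weightFil (k := k) g ω [i]

theorem map_mem_of_mem_weightFil [AddMonoid M] [Preorder M] {g : ι → A}
    {ω : ι → M} (φ : A →ₐ[k] B) {G : M → Submodule k B}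
    [SetLike.GradedMonoid G] (hG : Monotone G) (h : ∀ i, φ (g i) ∈ G (ω i)) {n : M} {a : A}
    (ha : a ∈ weightFil k g ω n) :
    φ a ∈ G n := by
  suffices weightFil k g ω n ≤ (G n).comap φ.toLinearMap from this ha
  refine weightFil_le_iff.2 fun l hl => hG hl ?_
  simpa [map_list_prod, List.map_map] using
    SetLike.list_prod_map_mem_graded l ω (φ ∘ g) fun i _ => h i

section Ordered

variable [AddCommMonoid M] [PartialOrder M] [IsOrderedAddMonoid M] {g : ι → A} {ω : ι → M}

instance : SetLike.GradedMonoid (weightFil k g ω) where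
  one_mem := Submodule.subset_span ⟨[], by simp, by simp⟩
  mul_mem m n a b ha hb := by
    have hab := Submodule.mul_mem_mul ha hb
    rw [weightFil, weightFil, Submodule.span_mul_span] at hab
    refine Submodule.span_mono ?_ hab
    rintro _ ⟨_, ⟨l, hl, rfl⟩, _, ⟨l', hl', rfl⟩, rfl⟩
    exact ⟨l ++ l', by simpa using add_le_add hl hl', by simp⟩

theorem weightFil_eq_bot (hω : ∀ i, 0 ≤ ω i) {n : M} (hn : n < 0) : weightFil k g ω n = ⊥ := by
  refine eq_bot_iff.2 (weightFil_le_iff.2 fun l hl => absurd (hl.trans_lt hn) (not_lt_of_ge ?_))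
  exact List.sum_nonneg (by simpa using fun i _ => hω i)

theorem weightFil_zero_le (hω : ∀ i, 0 < ω i) : weightFil k g ω 0 ≤ 1 := by
  refine weightFil_le_iff.2 fun l hl => ?_
  cases l with
  | nil => exact Submodule.one_le.1 (by simp)
  | cons i l =>
    have hl' : 0 ≤ (l.map ω).sum := List.sum_nonneg (by simpa using fun i _ => (hω i).le)
    exact absurd hl (not_le_of_gt (by simpa using add_pos_of_pos_of_nonneg (hω i) hl'))

end Ordered

theorem exists_mem_weightFil [AddCommMonoid M] [LinearOrder M] [IsOrderedAddMonoid M] {g : ι → A}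
    (hg : Algebra.adjoin k (Set.range g) = ⊤) (ω : ι → M) (c : A) : ∃ n, c ∈ weightFil k g ω n := by
  have hc : c ∈ Algebra.adjoin k (Set.range g) := hg ▸ Algebra.mem_top
  induction hc using Algebra.adjoin_induction with
  | mem c hc =>
    obtain ⟨i, rfl⟩ := hc
    exact ⟨ω i, generator_mem_weightFil g ω i⟩
  | algebraMap r => exact ⟨0, SetLike.algebraMap_mem_graded _ r⟩
  | add a b _ _ ha hb =>
    obtain ⟨m, ha⟩ := ha
    obtain ⟨n, hb⟩ := hb
    exact ⟨max m n, add_mem (monotone_weightFil g ω (le_max_left m n) ha)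
      (monotone_weightFil g ω (le_max_right m n) hb)⟩
  | mul a b _ _ ha hb =>
    obtain ⟨m, ha⟩ := ha
    obtain ⟨n, hb⟩ := hb
    exact ⟨m + n, SetLike.mul_mem_graded ha hb⟩

theorem weightFil_one_le {g : ι → A} {ω : ι → ℤ} (hω : ∀ i, 0 < ω i) {p : Submodule k A}
    (h1 : 1 ∈ p) (hp : ∀ i, ω i = 1 → g i ∈ p) : weightFil k g ω 1 ≤ p := by
  refine weightFil_le_iff.2 fun l hl => ?_
  have nonneg (l : List ι) : 0 ≤ (l.map ω).sum :=
    List.sum_nonneg (by simpa using fun i _ => (hω i).le)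
  match l, hl with
  | [], _ => simpa using h1
  | [i], hl => exact by simpa using hp i (le_antisymm (by simpa using hl) (hω i))
  | i :: j :: l, hl =>
    have := hω i
    have := hω j
    have := nonneg l
    simp only [List.map_cons, List.sum_cons] at hl
    omega

end WeightFiltration

section FilteredDerivation

variable {k A : Type*} [CommRing k] [Ring A] [Algebra k A]

/-- A linear endomorphism of a filtered algebra that lowers the filtration by `d` and satisfies the
Leibniz rule up to lower terms, so that it induces a derivation of degree `-d` of the associated
graded algebra. -/
structure IsFilteredDerivation (F : ℤ → Submodule k A) (d : ℤ) (D : Module.End k A) : Prop where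
  map_mem {n : ℤ} {a : A} : a ∈ F n → D a ∈ F (n - d)
  leibniz {m n : ℤ} {a b : A} : a ∈ F m → b ∈ F n →
    D (a * b) - (D a * b + a * D b) ∈ F (m + n - d - 1)

namespace IsFilteredDerivation

section Operations

variable {F : ℤ → Submodule k A} {d e : ℤ} {D E : Module.End k A}

theorem add (hD : IsFilteredDerivation F d D) (hE : IsFilteredDerivation F d E) :
    IsFilteredDerivation F d (D + E) where
  map_mem ha := add_mem (hD.map_mem ha) (hE.map_mem ha)
  leibniz {m n a b} ha hb := by
    convert add_mem (hD.leibniz ha hb) (hE.leibniz ha hb) using 1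
    simp only [LinearMap.add_apply]
    noncomm_ring

theorem lie [SetLike.GradedMonoid F] (hF : Monotone F) (hD : IsFilteredDerivation F d D)
    (hE : IsFilteredDerivation F e E) : IsFilteredDerivation F (d + e) ⁅D, E⁆ where
  map_mem ha := sub_mem (hF (by lia) (hD.map_mem (hE.map_mem ha)))
    (hF (by lia) (hE.map_mem (hD.map_mem ha)))
  leibniz {m n a b} ha hb := by
    have h₁ : _ ∈ F (m + n - (d + e) - 1) := hF (by lia) (hD.map_mem (hE.leibniz ha hb))
    have h₂ : _ ∈ F (m + n - (d + e) - 1) := hF (by lia) (hD.leibniz (hE.map_mem ha) hb)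
    have h₃ : _ ∈ F (m + n - (d + e) - 1) := hF (by lia) (hD.leibniz ha (hE.map_mem hb))
    have h₄ : _ ∈ F (m + n - (d + e) - 1) := hF (by lia) (hE.map_mem (hD.leibniz ha hb))
    have h₅ : _ ∈ F (m + n - (d + e) - 1) := hF (by lia) (hE.leibniz (hD.map_mem ha) hb)
    have h₆ : _ ∈ F (m + n - (d + e) - 1) := hF (by lia) (hE.leibniz ha (hD.map_mem hb))
    convert sub_mem (add_mem h₁ (add_mem h₂ h₃)) (add_mem h₄ (add_mem h₅ h₆)) using 1
    simp only [Ring.lie_def, LinearMap.sub_apply, Module.End.mul_apply, map_sub, map_add]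
    noncomm_ring

theorem mulLeft_mul [SetLike.GradedMonoid F] (hF : Monotone F) {p : A} (hp : p ∈ F e)
    (hcomm : ∀ {n a}, a ∈ F n → ⁅p, a⁆ ∈ F (e + n - 1)) (hD : IsFilteredDerivation F d D) :
    IsFilteredDerivation F (d - e) (LinearMap.mulLeft k p * D) where
  map_mem ha := hF (by lia) (SetLike.mul_mem_graded hp (hD.map_mem ha))
  leibniz {m n a b} ha hb := by
    have h₁ : _ ∈ F (m + n - (d - e) - 1) :=
      hF (by lia) (SetLike.mul_mem_graded hp (hD.leibniz ha hb))
    have h₂ : _ ∈ F (m + n - (d - e) - 1) :=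
      hF (by lia) (SetLike.mul_mem_graded (hcomm ha) (hD.map_mem hb))
    convert add_mem h₁ h₂ using 1
    simp only [Ring.lie_def, Module.End.mul_apply, LinearMap.mulLeft_apply]
    noncomm_ring

theorem mulLeft_sub_mulRight [SetLike.GradedMonoid F] (hF : Monotone F) {p : A} (hp : p ∈ F e) :
    IsFilteredDerivation F (-e) (LinearMap.mulLeft k p - LinearMap.mulRight k p) where
  map_mem {n a} ha := sub_mem (hF (by lia : e + n ≤ n - -e) (SetLike.mul_mem_graded hp ha))
    (hF (by lia : n + e ≤ n - -e) (SetLike.mul_mem_graded ha hp))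
  leibniz {m n a b} _ _ := by
    convert zero_mem (F (m + n - -e - 1)) using 1
    simp only [LinearMap.sub_apply, LinearMap.mulLeft_apply, LinearMap.mulRight_apply]
    noncomm_ring

end Operations

section Generators

variable {ι : Type*} {g : ι → A} {ω : ι → ℤ} {d : ℤ} {D : Module.End k A}

theorem map_prod_sub_smul_mem (hD : IsFilteredDerivation (weightFil k g ω) d D) {r : ι → k}
    (h : ∀ i, D (g i) - r i • g i ∈ weightFil k g ω (ω i - d - 1)) (l : List ι) :
    D (l.map g).prod - (l.map r).sum • (l.map g).prod ∈
      weightFil k g ω ((l.map ω).sum - d - 1) := by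
  induction l with
  | nil =>
    have h1 := hD.leibniz (SetLike.one_mem_graded _) (SetLike.one_mem_graded _)
    simpa using h1
  | cons i l ih =>
    have hg := generator_mem_weightFil (k := k) g ω i
    have hl := prod_mem_weightFil (k := k) g ω l
    have hF := monotone_weightFil (k := k) g ω
    simp only [List.map_cons, List.prod_cons, List.sum_cons]
    have h₁ : _ ∈ weightFil k g ω (ω i + (l.map ω).sum - d - 1) := hD.leibniz hg hl
    have h₂ : _ ∈ weightFil k g ω (ω i + (l.map ω).sum - d - 1) :=
      hF (by lia) (SetLike.mul_mem_graded (h i) hl)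
    have h₃ : _ ∈ weightFil k g ω (ω i + (l.map ω).sum - d - 1) :=
      hF (by lia) (SetLike.mul_mem_graded hg ih)
    convert add_mem h₁ (add_mem h₂ h₃) using 1
    rw [add_smul, sub_mul, mul_sub, smul_mul_assoc, mul_smul_comm]
    abel

theorem map_mem_of_generators (hD : IsFilteredDerivation (weightFil k g ω) d D)
    (h : ∀ i, D (g i) ∈ weightFil k g ω (ω i - d - 1)) {n : ℤ} {a : A}
    (ha : a ∈ weightFil k g ω n) : D a ∈ weightFil k g ω (n - d - 1) := by
  suffices weightFil k g ω n ≤ (weightFil k g ω (n - d - 1)).comap D from this ha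
  refine weightFil_le_iff.2 fun l hl => ?_
  have hw : D (l.map g).prod ∈ weightFil k g ω ((l.map ω).sum - d - 1) := by
    simpa using hD.map_prod_sub_smul_mem (r := fun _ => 0) (by simpa using h) l
  exact monotone_weightFil g ω (by lia) hw

theorem map_sub_smul_mem (hD : IsFilteredDerivation (weightFil k g ω) 0 D)
    (h : ∀ i, D (g i) - (ω i : k) • g i ∈ weightFil k g ω (ω i - 1)) {n : ℤ} {a : A}
    (ha : a ∈ weightFil k g ω n) : D a - (n : k) • a ∈ weightFil k g ω (n - 1) := by
  suffices weightFil k g ω n ≤ (weightFil k g ω (n - 1)).comap (D - (n : k) • 1) from this ha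
  refine weightFil_le_iff.2 fun l hl => ?_
  have hF := monotone_weightFil (k := k) g ω
  have hw := hD.map_prod_sub_smul_mem (r := fun i => (ω i : k)) (by simpa using h) l
  have hsum : (l.map fun i => (ω i : k)).sum = ((l.map ω).sum : ℤ) := by
    simp [Int.cast_list_sum, Function.comp_def]
  rw [hsum, sub_zero] at hw
  obtain hl | hl := hl.lt_or_eq
  · have hword := hF (Int.le_sub_one_of_lt hl) (prod_mem_weightFil (k := k) g ω l)
    have hDw := add_mem (hF (by lia) hw) (Submodule.smul_mem _ (((l.map ω).sum : ℤ) : k) hword)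
    exact sub_mem (by simpa using hDw) (Submodule.smul_mem _ _ hword)
  · simpa [hl] using hw

end Generators

end IsFilteredDerivation

theorem lie_mem_weightFil {ι : Type*} {g : ι → A} {ω : ι → ℤ} {p : A} {e : ℤ}
    (hp : p ∈ weightFil k g ω e) (h : ∀ i, ⁅p, g i⁆ ∈ weightFil k g ω (e + ω i - 1)) {n : ℤ} {a : A}
    (ha : a ∈ weightFil k g ω n) : ⁅p, a⁆ ∈ weightFil k g ω (e + n - 1) := by
  have hD := IsFilteredDerivation.mulLeft_sub_mulRight (monotone_weightFil g ω) hp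
  have hpa := hD.map_mem_of_generators (fun i => by simpa [add_comm, Ring.lie_def] using h i) ha
  simpa [add_comm, Ring.lie_def] using hpa

end FilteredDerivation

section Contraction

variable {k M N P : Type*} [CommRing k] [AddCommGroup M] [Module k M] [AddCommGroup N] [Module k N]
  [AddCommGroup P] [Module k P]

/-- The map `a ⊗ b ↦ f(b) a`, which is linear in the functional `f`. -/
def contractRight : Module.Dual k N →ₗ[k] M ⊗[k] N →ₗ[k] M :=
  LinearMap.compRight k (TensorProduct.rid k M).toLinearMap ∘ₗ LinearMap.lTensorHom M

@[simp]
theorem contractRight_tmul (f : Module.Dual k N) (a : M) (b : N) :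
    contractRight f (a ⊗ₜ[k] b) = f b • a := by
  simp [contractRight]

theorem contractRight_rTensor (f : Module.Dual k N) (φ : M →ₗ[k] P) (w : M ⊗[k] N) :
    contractRight f (φ.rTensor N w) = φ (contractRight f w) := by
  suffices contractRight f ∘ₗ φ.rTensor N = φ ∘ₗ contractRight f from LinearMap.congr_fun this w
  ext; simp

theorem contractRight_lTensor (f : Module.Dual k P) (φ : N →ₗ[k] P) (w : M ⊗[k] N) :
    contractRight f (φ.lTensor M w) = contractRight (f ∘ₗ φ) w := by
  suffices contractRight f ∘ₗ φ.lTensor M = contractRight (f ∘ₗ φ) from LinearMap.congr_fun this w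
  ext; simp

theorem lTensor_contractRight_assoc (f : Module.Dual k P) (w : M ⊗[k] N ⊗[k] P) :
    (contractRight f).lTensor M (TensorProduct.assoc k M N P w) = contractRight f w := by
  suffices (contractRight f).lTensor M ∘ₗ (TensorProduct.assoc k M N P).toLinearMap =
    contractRight f from LinearMap.congr_fun this w
  ext; simp

end Contraction

section Hit

variable {k C : Type*} [CommRing k]

section Coalgebra

variable [AddCommGroup C] [Module k C] [Coalgebra k C]

/-- The left comodule endomorphism `c ↦ f(c₂) c₁` given by a functional `f`. -/
def hit : Module.Dual k C →ₗ[k] Module.End k C :=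
  LinearMap.lcomp k C Coalgebra.comul ∘ₗ contractRight

theorem hit_apply (f : Module.Dual k C) (c : C) :
    hit f c = contractRight f (Coalgebra.comul (R := k) c) := rfl

theorem counit_hit (f : Module.Dual k C) (c : C) : Coalgebra.counit (R := k) (hit f c) = f c := by
  rw [hit_apply, ← contractRight_rTensor, Coalgebra.rTensor_counit_comul, contractRight_tmul,
    smul_eq_mul, mul_one]

theorem hit_counit (c : C) : hit (Coalgebra.counit (R := k)) c = c := by
  have h := congrArg (TensorProduct.rid k C) (Coalgebra.lTensor_counit_comul (R := k) c)
  exact h.trans (by simp)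

theorem hit_comp_hit (f g : Module.Dual k C) : hit (f ∘ₗ hit g) = hit f * hit g := by
  ext c
  calc hit (f ∘ₗ hit g) c
    _ = contractRight f ((contractRight g).lTensor C
          (Coalgebra.comul.lTensor C (Coalgebra.comul (R := k) c))) := by
        rw [hit_apply, ← contractRight_lTensor, ← LinearMap.lTensor_comp_apply]
        rfl
    _ = hit f (hit g c) := by
        rw [← Coalgebra.coassoc_apply, lTensor_contractRight_assoc, contractRight_rTensor]
        rfl

end Coalgebra

section Bialgebra

variable [Ring C] [Bialgebra k C]

theorem hit_one (f : Module.Dual k C) : hit f (1 : C) = f 1 • 1 := by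
  simp [hit_apply, Algebra.TensorProduct.one_def]

end Bialgebra

end Hit

section TensorFiltration

variable {k A : Type*} [CommRing k] [Ring A] [Algebra k A]

/-- The filtration induced on `A ⊗ A` by a filtration of `A`. -/
def tensorFil (F : ℤ → Submodule k A) (n : ℤ) : Submodule k (A ⊗[k] A) :=
  Submodule.span k {s | ∃ i j, i + j ≤ n ∧ ∃ a ∈ F i, ∃ b ∈ F j, a ⊗ₜ[k] b = s}

variable {F : ℤ → Submodule k A}

theorem tmul_mem_tensorFil {i j n : ℤ} (h : i + j ≤ n) {a b : A} (ha : a ∈ F i) (hb : b ∈ F j) :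
    a ⊗ₜ[k] b ∈ tensorFil F n :=
  Submodule.subset_span ⟨i, j, h, a, ha, b, hb, rfl⟩

theorem monotone_tensorFil (F : ℤ → Submodule k A) : Monotone (tensorFil F) :=
  fun _ _ h => Submodule.span_mono fun _ ⟨i, j, hij, hs⟩ => ⟨i, j, hij.trans h, hs⟩

instance [SetLike.GradedMonoid F] : SetLike.GradedMonoid (tensorFil F) where
  one_mem := tmul_mem_tensorFil (zero_add 0).le (SetLike.one_mem_graded F)
    (SetLike.one_mem_graded F)
  mul_mem m n s t hs ht := by
    have hst := Submodule.mul_mem_mul hs ht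
    rw [tensorFil, tensorFil, Submodule.span_mul_span] at hst
    refine Submodule.span_mono ?_ hst
    rintro _ ⟨_, ⟨i, j, hij, a, ha, b, hb, rfl⟩, _, ⟨i', j', hij', a', ha', b', hb', rfl⟩, rfl⟩
    exact ⟨i + i', j + j', by lia, a * a', SetLike.mul_mem_graded ha ha', b * b',
      SetLike.mul_mem_graded hb hb', by simp⟩

theorem contractRight_mem (hF : Monotone F) {f : Module.Dual k A} {m : ℤ} (hf : ∀ a ∈ F m, f a = 0)
    {n : ℤ} {s : A ⊗[k] A} (hs : s ∈ tensorFil F n) : contractRight f s ∈ F (n - m - 1) := by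
  suffices tensorFil F n ≤ (F (n - m - 1)).comap (contractRight f) from this hs
  refine Submodule.span_le.2 ?_
  rintro _ ⟨i, j, hij, a, ha, b, hb, rfl⟩
  simp only [SetLike.mem_coe, Submodule.mem_comap, contractRight_tmul]
  obtain hj | hj := le_or_gt j m
  · rw [hf b (hF hj hb), zero_smul]
    exact zero_mem _
  · exact Submodule.smul_mem _ _ (hF (by lia) ha)

end TensorFiltration

section FilteredBialgebra

variable {k A : Type*} [CommRing k] [Ring A] [Bialgebra k A] {F : ℤ → Submodule k A}

theorem contractRight_mul_sub_mem [SetLike.GradedMonoid F] (hF : Monotone F) (hF0 : F 0 ≤ 1)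
    {f : Module.Dual k A} (hf : f 1 = 0) {m n : ℤ} {s t : A ⊗[k] A} (hs : s ∈ tensorFil F m)
    (ht : t ∈ tensorFil F n) :
    contractRight f (s * t) - (contractRight f s * contractRight Coalgebra.counit t +
      contractRight Coalgebra.counit s * contractRight f t) ∈ F (m + n - 2) := by
  induction hs, ht using Submodule.span_induction₂ with
  | mem_mem _ _ hs ht =>
    obtain ⟨i, j, hij, a, ha, b, hb, rfl⟩ := hs
    obtain ⟨i', j', hij', a', ha', b', hb', rfl⟩ := ht
    have expand : contractRight f (a ⊗ₜ[k] b * a' ⊗ₜ[k] b') -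
        (contractRight f (a ⊗ₜ[k] b) * contractRight Coalgebra.counit (a' ⊗ₜ[k] b') +
          contractRight Coalgebra.counit (a ⊗ₜ[k] b) * contractRight f (a' ⊗ₜ[k] b')) =
        (f (b * b') - (f b * Coalgebra.counit b' + Coalgebra.counit b * f b')) • (a * a') := by
      simp only [Algebra.TensorProduct.tmul_mul_tmul, contractRight_tmul, smul_mul_smul_comm,
        sub_smul, add_smul]
    rw [expand]
    obtain hj | hj := le_or_gt j 0
    · obtain ⟨r, rfl⟩ := Submodule.mem_one.1 (hF0 (hF hj hb))
      simp [Algebra.algebraMap_eq_smul_one, hf]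
    obtain hj' | hj' := le_or_gt j' 0
    · obtain ⟨r, rfl⟩ := Submodule.mem_one.1 (hF0 (hF hj' hb'))
      simp [Algebra.algebraMap_eq_smul_one, hf, mul_comm]
    · exact Submodule.smul_mem _ _ (hF (by lia) (SetLike.mul_mem_graded ha ha'))
  | zero_left | zero_right => simp
  | add_left s s' t _ _ _ h h' =>
    convert add_mem h h' using 1
    simp only [map_add, add_mul]
    abel
  | add_right s t t' _ _ _ h h' =>
    convert add_mem h h' using 1
    simp only [map_add, mul_add]
    abel
  | smul_left r s t _ _ h =>
    simpa only [map_smul, smul_mul_assoc, ← smul_add, ← smul_sub] using Submodule.smul_mem _ r h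
  | smul_right r s t _ _ h =>
    simpa only [map_smul, mul_smul_comm, ← smul_add, ← smul_sub] using Submodule.smul_mem _ r h

theorem isFilteredDerivation_hit [SetLike.GradedMonoid F] (hF : Monotone F) (hF0 : F 0 ≤ 1)
    (hΔ : ∀ {n a}, a ∈ F n → Coalgebra.comul (R := k) a ∈ tensorFil F n) {f : Module.Dual k A}
    (hf : f 1 = 0) : IsFilteredDerivation F 1 (hit f) where
  map_mem {n a} ha := by
    have hf0 (b : A) (hb : b ∈ F 0) : f b = 0 := by
      obtain ⟨r, rfl⟩ := Submodule.mem_one.1 (hF0 hb)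
      simp [Algebra.algebraMap_eq_smul_one, hf]
    exact hF (by lia : n - 0 - 1 ≤ n - 1) (contractRight_mem hF hf0 (hΔ ha))
  leibniz {m n a b} ha hb := by
    have h := contractRight_mul_sub_mem hF hF0 hf (hΔ ha) (hΔ hb)
    rw [← Bialgebra.comul_mul, ← hit_apply, ← hit_apply, ← hit_apply, ← hit_apply, ← hit_apply,
      hit_counit, hit_counit] at h
    exact hF (by lia) h

theorem comul_mem_tensorFil {ι : Type*} {g : ι → A} {ω : ι → ℤ}
    (h : ∀ i, Coalgebra.comul (R := k) (g i) ∈ tensorFil (weightFil k g ω) (ω i)) {n : ℤ} {a : A}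
    (ha : a ∈ weightFil k g ω n) :
    Coalgebra.comul (R := k) a ∈ tensorFil (weightFil k g ω) n :=
  map_mem_of_mem_weightFil (Bialgebra.comulAlgHom k A) (monotone_tensorFil _) h ha

end FilteredBialgebra

section DualLie

variable {k C : Type*} [CommRing k] [AddCommGroup C] [Module k C] [Coalgebra k C]

/-- The commutator of two functionals in the convolution algebra dual to a coalgebra. -/
def dualLie (f g : Module.Dual k C) : Module.Dual k C :=
  f ∘ₗ hit g - g ∘ₗ hit f

theorem dualLie_apply (f g : Module.Dual k C) (c : C) :
    dualLie f g c = f (hit g c) - g (hit f c) := rfl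

theorem hit_dualLie (f g : Module.Dual k C) : hit (dualLie f g) = ⁅hit f, hit g⁆ := by
  rw [dualLie, map_sub, hit_comp_hit, hit_comp_hit, Ring.lie_def]

theorem hit_dualLie_apply (f g : Module.Dual k C) (c : C) :
    hit (dualLie f g) c = hit f (hit g c) - hit g (hit f c) := by
  rw [hit_dualLie]; rfl

end DualLie

theorem dualLie_apply_one {k C : Type*} [CommRing k] [Ring C] [Bialgebra k C]
    {f g : Module.Dual k C} (hf : f 1 = 0) (hg : g 1 = 0) : dualLie f g 1 = 0 := by
  simp [dualLie_apply, hit_one, hf, hg]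

section Primitive

variable {k C : Type*} [Field k] [Ring C] [HopfAlgebra k C]

theorem hit_of_isPrimitiveElt {p : C} (hp : IsPrimitiveElt k p) (f : Module.Dual k C) :
    hit f p = f 1 • p + f p • 1 := by
  rw [hit_apply, hp]
  simp

theorem counit_of_isPrimitiveElt {p : C} (hp : IsPrimitiveElt k p) :
    Coalgebra.counit (R := k) p = 0 := by
  have h := hit_counit (k := k) p
  rw [hit_of_isPrimitiveElt hp, Bialgebra.counit_one, one_smul, add_eq_left] at h
  simpa using congrArg (Coalgebra.counit (R := k)) h

end Primitive

theorem exists_eq_comp_add_comp {k V V' : Type*} [Field k] [AddCommGroup V] [Module k V]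
    [AddCommGroup V'] [Module k V'] (φ ψ : V →ₗ[k] V') (W : Submodule k V') {h : Module.Dual k V}
    (hh : ∀ v, φ v ∈ W → ψ v ∈ W → h v = 0) :
    ∃ p q : Module.Dual k V', (∀ w ∈ W, p w = 0) ∧ (∀ w ∈ W, q w = 0) ∧ h = p ∘ₗ φ + q ∘ₗ ψ := by
  let θ : V →ₗ[k] (V' ⧸ W) × (V' ⧸ W) := (W.mkQ ∘ₗ φ).prod (W.mkQ ∘ₗ ψ)
  have hmem : h ∈ LinearMap.range θ.dualMap := by
    rw [LinearMap.range_dualMap_eq_dualAnnihilator_ker, Submodule.mem_dualAnnihilator]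
    intro v hv
    have hv' : (W.mkQ (φ v), W.mkQ (ψ v)) = 0 := hv
    rw [Prod.mk_eq_zero, Submodule.mkQ_apply, Submodule.mkQ_apply, Submodule.Quotient.mk_eq_zero,
      Submodule.Quotient.mk_eq_zero] at hv'
    exact hh v hv'.1 hv'.2
  obtain ⟨χ, rfl⟩ := hmem
  refine ⟨χ ∘ₗ LinearMap.inl k _ _ ∘ₗ W.mkQ, χ ∘ₗ LinearMap.inr k _ _ ∘ₗ W.mkQ, fun w hw => ?_,
    fun w hw => ?_, ?_⟩
  · simp [(Submodule.Quotient.mk_eq_zero W).2 hw, ← Prod.zero_eq_mk]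
  · simp [(Submodule.Quotient.mk_eq_zero W).2 hw, ← Prod.zero_eq_mk]
  · ext v
    simp [θ, ← map_add]

section ThinTriple

variable (k : Type*) {C : Type*} [Field k] [Ring C] [HopfAlgebra k C]

/-- The filtration of `C` in which `x` and `y` have weight one and `z` has weight two. -/
abbrev thinFil (x y z : C) : ℤ → Submodule k C :=
  weightFil k ![x, y, z] ![1, 1, 2]

/-- Two primitive generators `x`, `y` and a third generator `z` with
`δ(z) = x ⊗ y - y ⊗ x`, which commute up to terms of lower weight, together with functionals
`ξ` and `η` dual to `x` and `y`. -/
structure ThinTriple (x y z : C) (ξ η : Module.Dual k C) : Prop where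
  primitive_x : IsPrimitiveElt k x
  primitive_y : IsPrimitiveElt k y
  comul_z : Coalgebra.comul (R := k) z = 1 ⊗ₜ[k] z + x ⊗ₜ[k] y - y ⊗ₜ[k] x + z ⊗ₜ[k] 1
  lie_xy : ⁅x, y⁆ ∈ thinFil k x y z 1
  lie_xz : ⁅x, z⁆ ∈ thinFil k x y z 2
  lie_yz : ⁅y, z⁆ ∈ thinFil k x y z 2
  adjoin_eq_top : Algebra.adjoin k {x, y, z} = ⊤
  ξ_one : ξ 1 = 0
  ξ_x : ξ x = 1
  ξ_y : ξ y = 0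
  η_one : η 1 = 0
  η_x : η x = 0
  η_y : η y = 1

variable {k} {x y z : C} {ξ η : Module.Dual k C}

theorem monotone_thinFil : Monotone (thinFil k x y z) :=
  monotone_weightFil _ _

theorem thinFil_eq_bot {n : ℤ} (hn : n < 0) : thinFil k x y z n = ⊥ :=
  weightFil_eq_bot (by simp [Fin.forall_fin_succ]) hn

theorem eq_zero_of_mem_thinFil {n : ℤ} (hn : n < 0) {c : C} (hc : c ∈ thinFil k x y z n) :
    c = 0 := by
  rwa [thinFil_eq_bot hn, Submodule.mem_bot] at hc

theorem thinFil_zero_le : thinFil k x y z 0 ≤ 1 :=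
  weightFil_zero_le (by simp [Fin.forall_fin_succ])

theorem one_mem_thinFil {n : ℤ} (hn : 0 ≤ n) : (1 : C) ∈ thinFil k x y z n :=
  monotone_thinFil hn (SetLike.one_mem_graded _)

theorem x_mem_thinFil : x ∈ thinFil k x y z 1 :=
  generator_mem_weightFil ![x, y, z] ![(1 : ℤ), 1, 2] 0

theorem y_mem_thinFil : y ∈ thinFil k x y z 1 :=
  generator_mem_weightFil ![x, y, z] ![(1 : ℤ), 1, 2] 1

theorem z_mem_thinFil : z ∈ thinFil k x y z 2 :=
  generator_mem_weightFil ![x, y, z] ![(1 : ℤ), 1, 2] 2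

theorem apply_eq_zero_of_mem_thinFil_one {f : Module.Dual k C} (h1 : f 1 = 0) (hx : f x = 0)
    (hy : f y = 0) {c : C} (hc : c ∈ thinFil k x y z 1) : f c = 0 := by
  have hle : thinFil k x y z 1 ≤ LinearMap.ker f :=
    weightFil_one_le (by simp [Fin.forall_fin_succ]) h1 (by simp [Fin.forall_fin_succ, hx, hy])
  exact hle hc

namespace ThinTriple

variable (T : ThinTriple k x y z ξ η)
include T

theorem hit_z (f : Module.Dual k C) : hit f z = f z • 1 + f y • x - f x • y + f 1 • z := by
  rw [hit_apply, T.comul_z]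
  simp

theorem exists_mem_thinFil (c : C) : ∃ n, c ∈ thinFil k x y z n := by
  refine exists_mem_weightFil ?_ _ c
  rw [← T.adjoin_eq_top]
  congr 1
  ext
  simp only [Set.mem_range, Fin.exists_fin_succ, Set.mem_insert_iff, Set.mem_singleton_iff]
  simp [eq_comm]

theorem comul_mem {n : ℤ} {c : C} (hc : c ∈ thinFil k x y z n) :
    Coalgebra.comul (R := k) c ∈ tensorFil (thinFil k x y z) n := by
  refine comul_mem_tensorFil ?_ hc
  have hx := x_mem_thinFil (k := k) (x := x) (y := y) (z := z)
  have hy := y_mem_thinFil (k := k) (x := x) (y := y) (z := z)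
  have hz := z_mem_thinFil (k := k) (x := x) (y := y) (z := z)
  have h1 := one_mem_thinFil (k := k) (x := x) (y := y) (z := z) le_rfl
  have primitive_mem {p : C} (hp : IsPrimitiveElt k p) (hp1 : p ∈ thinFil k x y z 1) :
      Coalgebra.comul (R := k) p ∈ tensorFil (thinFil k x y z) 1 := by
    rw [hp]
    exact add_mem (tmul_mem_tensorFil (by lia) hp1 h1) (tmul_mem_tensorFil (by lia) h1 hp1)
  have z_comul_mem : Coalgebra.comul (R := k) z ∈ tensorFil (thinFil k x y z) 2 := by
    rw [T.comul_z]
    exact add_mem (sub_mem (add_mem (tmul_mem_tensorFil (by lia) h1 hz)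
      (tmul_mem_tensorFil (by lia) hx hy)) (tmul_mem_tensorFil (by lia) hy hx))
      (tmul_mem_tensorFil (by lia) hz h1)
  simpa [Fin.forall_fin_succ] using
    ⟨primitive_mem T.primitive_x hx, primitive_mem T.primitive_y hy, z_comul_mem⟩

theorem hit_mem {f : Module.Dual k C} {m : ℤ} (hf : ∀ a ∈ thinFil k x y z m, f a = 0) {n : ℤ}
    {c : C} (hc : c ∈ thinFil k x y z n) : hit f c ∈ thinFil k x y z (n - m - 1) :=
  contractRight_mem monotone_thinFil hf (T.comul_mem hc)

theorem isFilteredDerivation_hit {f : Module.Dual k C} (hf : f 1 = 0) :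
    IsFilteredDerivation (thinFil k x y z) 1 (hit f) :=
  ThinHopf.isFilteredDerivation_hit monotone_thinFil thinFil_zero_le T.comul_mem hf

theorem isFilteredDerivation_hit_dualLie :
    IsFilteredDerivation (thinFil k x y z) 2 (hit (dualLie ξ η)) := by
  rw [hit_dualLie]
  exact (T.isFilteredDerivation_hit T.ξ_one).lie monotone_thinFil
    (T.isFilteredDerivation_hit T.η_one)

theorem lie_generator_mem (i : Fin 3) {n : ℤ} {c : C} (hc : c ∈ thinFil k x y z n) :
    ⁅![x, y, z] i, c⁆ ∈ thinFil k x y z ((![1, 1, 2] : Fin 3 → ℤ) i + n - 1) := by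
  have lie_comm_mem {a b : C} {m : ℤ} (h : ⁅a, b⁆ ∈ thinFil k x y z m) :
      ⁅b, a⁆ ∈ thinFil k x y z m := by
    simpa [Ring.lie_def] using neg_mem h
  have lie_self_mem (a : C) (m : ℤ) : ⁅a, a⁆ ∈ thinFil k x y z m := by simp [Ring.lie_def]
  refine lie_mem_weightFil (generator_mem_weightFil _ _ i) ?_ hc
  revert i
  simpa [Fin.forall_fin_succ, lie_self_mem] using ⟨⟨T.lie_xy, T.lie_xz⟩,
    ⟨lie_comm_mem T.lie_xy, T.lie_yz⟩, lie_comm_mem T.lie_xz, lie_comm_mem T.lie_yz⟩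

theorem dualLie_one : dualLie ξ η 1 = 0 :=
  dualLie_apply_one T.ξ_one T.η_one

theorem dualLie_x : dualLie ξ η x = 0 := by
  simp [dualLie_apply, hit_of_isPrimitiveElt T.primitive_x, T.ξ_one, T.η_one]

theorem dualLie_y : dualLie ξ η y = 0 := by
  simp [dualLie_apply, hit_of_isPrimitiveElt T.primitive_y, T.ξ_one, T.η_one]

theorem dualLie_z : dualLie ξ η z = 2 := by
  simp only [dualLie_apply, T.hit_z, map_add, map_sub, map_smul, smul_eq_mul, T.ξ_one, T.ξ_x,
    T.ξ_y, T.η_one, T.η_x, T.η_y]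
  norm_num

theorem lie_hit_hit_dualLie_mem {f : Module.Dual k C} (hf : f 1 = 0) {n : ℤ} {c : C}
    (hc : c ∈ thinFil k x y z n) : ⁅hit f, hit (dualLie ξ η)⁆ c ∈ thinFil k x y z (n - 4) := by
  have hD := (T.isFilteredDerivation_hit hf).lie monotone_thinFil
    T.isFilteredDerivation_hit_dualLie
  suffices ∀ i, ⁅hit f, hit (dualLie ξ η)⁆ (![x, y, z] i) = 0 from
    monotone_thinFil (by lia) (hD.map_mem_of_generators (fun i => by simp [this i]) hc)
  simp [Fin.forall_fin_succ, Ring.lie_def, hit_of_isPrimitiveElt T.primitive_x,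
    hit_of_isPrimitiveElt T.primitive_y, T.hit_z, hit_one, hf, T.dualLie_one, T.dualLie_x,
    T.dualLie_y]

theorem euler {n : ℤ} {c : C} (hc : c ∈ thinFil k x y z n) :
    x * hit ξ c + y * hit η c + z * hit (dualLie ξ η) c - (n : k) • c ∈
      thinFil k x y z (n - 1) := by
  have hx := (T.isFilteredDerivation_hit T.ξ_one).mulLeft_mul monotone_thinFil x_mem_thinFil
    (T.lie_generator_mem 0)
  have hy := (T.isFilteredDerivation_hit T.η_one).mulLeft_mul monotone_thinFil y_mem_thinFil
    (T.lie_generator_mem 1)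
  have hz := T.isFilteredDerivation_hit_dualLie.mulLeft_mul monotone_thinFil z_mem_thinFil
    (T.lie_generator_mem 2)
  refine ((hx.add hy).add hz).map_sub_smul_mem ?_ hc
  have z_mem : x * (ξ z • 1 - y) + y * (η z • 1 + x) ∈ thinFil k x y z 1 := by
    have h := add_mem (add_mem (Submodule.smul_mem _ (ξ z) (x_mem_thinFil (k := k)))
      (Submodule.smul_mem _ (η z) (y_mem_thinFil (k := k)))) (neg_mem T.lie_xy)
    convert h using 1
    simp only [Ring.lie_def, mul_add, mul_sub, mul_smul_comm, mul_one]
    abel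
  simpa [Fin.forall_fin_succ, hit_of_isPrimitiveElt T.primitive_x,
    hit_of_isPrimitiveElt T.primitive_y, T.hit_z, T.ξ_one, T.ξ_x, T.ξ_y, T.η_one, T.η_x, T.η_y,
    T.dualLie_one, T.dualLie_x, T.dualLie_y, T.dualLie_z] using z_mem

section CharZero

variable [CharZero k]

theorem mem_of_hit_mem {m : ℤ} (hm : 0 ≤ m) {c : C} (hξ : hit ξ c ∈ thinFil k x y z (m - 1))
    (hη : hit η c ∈ thinFil k x y z (m - 1)) : c ∈ thinFil k x y z m := by
  obtain ⟨N, hN⟩ := T.exists_mem_thinFil c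
  obtain hNm | hmN := le_total N m
  · exact monotone_thinFil hNm hN
  induction N, hmN using Int.leInduction with
  | base => exact hN
  | succ N hmN ih =>
    refine ih ?_
    have hζ : hit (dualLie ξ η) c ∈ thinFil k x y z (m - 2) := by
      rw [hit_dualLie_apply]
      exact monotone_thinFil (by lia) (sub_mem
        ((T.isFilteredDerivation_hit T.ξ_one).map_mem hη)
        ((T.isFilteredDerivation_hit T.η_one).map_mem hξ))
    have hx : x * hit ξ c ∈ thinFil k x y z N :=
      monotone_thinFil (by lia) (SetLike.mul_mem_graded x_mem_thinFil hξ)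
    have hy : y * hit η c ∈ thinFil k x y z N :=
      monotone_thinFil (by lia) (SetLike.mul_mem_graded y_mem_thinFil hη)
    have hz : z * hit (dualLie ξ η) c ∈ thinFil k x y z N :=
      monotone_thinFil (by lia) (SetLike.mul_mem_graded z_mem_thinFil hζ)
    have hNk : ((N + 1 : ℤ) : k) ≠ 0 := Int.cast_ne_zero.2 (by lia)
    rw [← Submodule.smul_mem_iff _ hNk]
    simpa using sub_mem (add_mem (add_mem hx hy) hz)
      (monotone_thinFil (by lia : N + 1 - 1 ≤ N) (T.euler hN))

end CharZero

end ThinTriple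

end ThinTriple

namespace ThinTriple

section Antiderivative

variable {k C : Type*} [Field k] [Ring C] [HopfAlgebra k C] {x y z : C} {ξ η : Module.Dual k C}
  (T : ThinTriple k x y z ξ η)
include T

theorem hit_mul_add_sub_mem {f : Module.Dual k C} (hf : f 1 = 0) {n : ℤ} {α β γ : C}
    (hα : α ∈ thinFil k x y z (n - 1)) (hβ : β ∈ thinFil k x y z (n - 1))
    (hγ : γ ∈ thinFil k x y z (n - 2)) :
    hit f (x * α + y * β + z * γ) - (f x • α + x * hit f α + (f y • β + y * hit f β) +
      ((f y • x - f x • y) * γ + z * hit f γ)) ∈ thinFil k x y z (n - 2) := by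
  have hD := T.isFilteredDerivation_hit hf
  have hx : _ ∈ thinFil k x y z (n - 2) :=
    monotone_thinFil (by lia) (hD.leibniz x_mem_thinFil hα)
  have hy : _ ∈ thinFil k x y z (n - 2) :=
    monotone_thinFil (by lia) (hD.leibniz y_mem_thinFil hβ)
  have hz : _ ∈ thinFil k x y z (n - 2) :=
    monotone_thinFil (by lia) (hD.leibniz z_mem_thinFil hγ)
  convert add_mem (add_mem (add_mem hx hy) hz) (Submodule.smul_mem _ (f z) hγ) using 1
  simp only [map_add, hit_of_isPrimitiveElt T.primitive_x, hit_of_isPrimitiveElt T.primitive_y,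
    T.hit_z, hf, zero_smul, zero_add, add_zero, smul_one_mul, add_mul, sub_mul]
  abel

theorem exists_hit_sub_mem [CharZero k] {n : ℤ} (hn : n ≠ 0) {α β : C}
    (hα : α ∈ thinFil k x y z (n - 1)) (hβ : β ∈ thinFil k x y z (n - 1))
    (hξ : hit ξ (hit ξ β - hit η α) - hit (dualLie ξ η) α ∈ thinFil k x y z (n - 4))
    (hη : hit η (hit ξ β - hit η α) - hit (dualLie ξ η) β ∈ thinFil k x y z (n - 4)) :
    ∃ c ∈ thinFil k x y z n,
      hit ξ c - α ∈ thinFil k x y z (n - 2) ∧ hit η c - β ∈ thinFil k x y z (n - 2) := by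
  -- The antiderivative is `c / n` by Euler's identity, where `γ` stands for `⁅ξ, η⁆` applied to it.
  set γ := hit ξ β - hit η α with hγ_def
  set c := x * α + y * β + z * γ
  have hγ : γ ∈ thinFil k x y z (n - 2) := monotone_thinFil (by lia) <|
    sub_mem ((T.isFilteredDerivation_hit T.ξ_one).map_mem hβ)
      ((T.isFilteredDerivation_hit T.η_one).map_mem hα)
  have hc : c ∈ thinFil k x y z n := add_mem (add_mem
    (monotone_thinFil (by lia) (SetLike.mul_mem_graded x_mem_thinFil hα))
    (monotone_thinFil (by lia) (SetLike.mul_mem_graded y_mem_thinFil hβ)))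
    (monotone_thinFil (by lia) (SetLike.mul_mem_graded z_mem_thinFil hγ))
  have euler {a : C} (ha : a ∈ thinFil k x y z (n - 1)) :
      _ ∈ thinFil k x y z (n - 2) := monotone_thinFil (by lia) (T.euler ha)
  have z_mul_mem {a : C} (ha : a ∈ thinFil k x y z (n - 4)) : z * a ∈ thinFil k x y z (n - 2) :=
    monotone_thinFil (by lia) (SetLike.mul_mem_graded z_mem_thinFil ha)
  have hξc : hit ξ c - (n : k) • α ∈ thinFil k x y z (n - 2) := by
    convert add_mem (add_mem (T.hit_mul_add_sub_mem T.ξ_one hα hβ hγ) (euler hα)) (z_mul_mem hξ)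
      using 1
    rw [T.ξ_x, T.ξ_y, (sub_eq_iff_eq_add.1 hγ_def.symm : hit ξ β = γ + hit η α)]
    push_cast
    simp only [sub_smul, one_smul, zero_smul, zero_sub, neg_mul, mul_add, mul_sub]
    abel
  have hηc : hit η c - (n : k) • β ∈ thinFil k x y z (n - 2) := by
    convert add_mem (add_mem (T.hit_mul_add_sub_mem T.η_one hα hβ hγ) (euler hβ)) (z_mul_mem hη)
      using 1
    rw [T.η_x, T.η_y, (sub_eq_iff_eq_add.1 hγ_def.symm : hit ξ β = γ + hit η α)]
    push_cast
    simp only [sub_smul, one_smul, zero_smul, sub_zero, mul_add, mul_sub]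
    abel
  have hnk : (n : k) ≠ 0 := Int.cast_ne_zero.2 hn
  have rescale {f : Module.Dual k C} {a : C}
      (h : hit f c - (n : k) • a ∈ thinFil k x y z (n - 2)) :
      hit f ((n : k)⁻¹ • c) - a ∈ thinFil k x y z (n - 2) := by
    simpa [smul_sub, hnk] using Submodule.smul_mem _ (n : k)⁻¹ h
  exact ⟨(n : k)⁻¹ • c, Submodule.smul_mem _ _ hc, rescale hξc, rescale hηc⟩

end Antiderivative

end ThinTriple

section SplitLast

variable {k V : Type*} [CommRing k] [AddCommGroup V] [Module k V]

/-- The representation of the tensor algebra `T` on `(T ⊗ V) × k` in which `v` acts by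
`(s, r) ↦ (v s + r (1 ⊗ v), 0)`. -/
def splitLastAction :
    TensorAlgebra k V →ₐ[k] Module.End k ((TensorAlgebra k V ⊗[k] V) × k) :=
  TensorAlgebra.lift k <| LinearMap.mk₂ k
    (fun v p => (TensorAlgebra.ι k v • p.1 + p.2 • (1 ⊗ₜ[k] v), 0))
    (fun v w p => by
      simp only [map_add, add_smul, TensorProduct.tmul_add, smul_add, Prod.mk_add_mk, add_zero]
      rw [add_add_add_comm])
    (fun r v p => by simp [smul_comm p.2 r])
    (fun v p q => by
      simp only [Prod.fst_add, Prod.snd_add, smul_add, add_smul, Prod.mk_add_mk, add_zero]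
      rw [add_add_add_comm])
    (fun r v p => by simp [mul_smul, smul_comm r])

/-- The map `a v ↦ a ⊗ v` on the tensor algebra, for `v` of degree one. -/
def splitLast : TensorAlgebra k V →ₗ[k] TensorAlgebra k V ⊗[k] V :=
  LinearMap.fst k _ _ ∘ₗ LinearMap.applyₗ (0, 1) ∘ₗ splitLastAction.toLinearMap

theorem splitLastAction_inl (a : TensorAlgebra k V) (s : TensorAlgebra k V ⊗[k] V) :
    splitLastAction a (s, 0) = (a • s, 0) := by
  induction a using TensorAlgebra.induction generalizing s with
  | algebraMap r => simp
  | ι v => simp [splitLastAction]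
  | mul a b ha hb => rw [map_mul, Module.End.mul_apply, hb, ha, mul_smul]
  | add a b ha hb => rw [map_add, LinearMap.add_apply, ha, hb, add_smul]; simp

@[simp]
theorem splitLast_mul_ι (a : TensorAlgebra k V) (v : V) :
    splitLast (a * TensorAlgebra.ι k v) = a ⊗ₜ[k] v := by
  have hv : splitLastAction (TensorAlgebra.ι k v) ((0, 1) : (TensorAlgebra k V ⊗[k] V) × k) =
      (1 ⊗ₜ[k] v, 0) := by
    simp [splitLastAction]
  simp [splitLast, hv, splitLastAction_inl, TensorProduct.smul_tmul']

end SplitLast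

theorem eq_zero_of_contractRight_eq_zero {k M N : Type*} [Field k] [AddCommGroup M] [Module k M]
    [AddCommGroup N] [Module k N] {w : M ⊗[k] N}
    (h : ∀ f : Module.Dual k N, contractRight f w = 0) : w = 0 := by
  classical
  let b := Module.Basis.ofVectorSpace k N
  refine (TensorProduct.equivFinsuppOfBasisRight (M := M) b).injective (Finsupp.ext fun i => ?_)
  have coord : Finsupp.lapply i ∘ₗ (TensorProduct.equivFinsuppOfBasisRight (M := M) b).toLinearMap =
      contractRight (b.coord i) := by
    ext; simp
  rw [map_zero, Finsupp.zero_apply, ← h (b.coord i)]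
  exact LinearMap.congr_fun coord w

section Slice

variable {k C : Type*} [Field k] [Ring C] [HopfAlgebra k C]

theorem cobarDegree_two_ext {N : Type*} [AddCommGroup N] [Module k N] {φ ψ : Cobar k C →ₗ[k] N}
    (h : ∀ a b : C, φ (cobarOne k a * cobarOne k b) = ψ (cobarOne k a * cobarOne k b))
    {w : Cobar k C} (hw : w ∈ cobarDegree k C 2) : φ w = ψ w := by
  rw [cobarDegree, pow_two] at hw
  induction hw using Submodule.mul_induction_on' with
  | mem_mul_mem _ ha _ hb =>
    obtain ⟨a, rfl⟩ := ha
    obtain ⟨b, rfl⟩ := hb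
    rw [← cobarOne_of_mem k a.2, ← cobarOne_of_mem k b.2, h]
  | add a _ b _ ha hb => rw [map_add, map_add, ha, hb]

theorem cobarOne_one : cobarOne k (1 : C) = 0 := by
  have h : augProj k (1 : C) = 0 := by ext; simp [augProj_coe]
  rw [cobarOne, LinearMap.comp_apply, h, map_zero]

/-- The contraction `[a₁|⋯|aₙ] ↦ f(aₙ) [a₁|⋯|aₙ₋₁]` of the cobar construction. -/
def cobarSlice : Module.Dual k C →ₗ[k] Cobar k C →ₗ[k] Cobar k C :=
  LinearMap.lcomp k _ splitLast ∘ₗ contractRight ∘ₗ LinearMap.lcomp k _ (augKer k C).subtype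

theorem cobarSlice_mul_cobarOne (f : Module.Dual k C) (a : Cobar k C) (c : C) :
    cobarSlice f (a * cobarOne k c) = (f c - Coalgebra.counit (R := k) c * f 1) • a := by
  simp [cobarSlice, cobarOne, augProj_coe, Algebra.algebraMap_eq_smul_one]

/-- The slice `(id ⊗ f)(w)` in `C` of the component of `w` in `C⁺ ⊗ C⁺`. -/
def slice : Module.Dual k C →ₗ[k] Cobar k C →ₗ[k] C :=
  LinearMap.compRight k ((augKer k C).subtype ∘ₗ TensorAlgebra.ιInv) ∘ₗ cobarSlice

theorem slice_apply (f : Module.Dual k C) (w : Cobar k C) :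
    slice f w = (TensorAlgebra.ιInv (cobarSlice f w) : augKer k C) := rfl

theorem coe_ιInv_cobarOne (c : C) :
    ((TensorAlgebra.ιInv (cobarOne k c) : augKer k C) : C) =
      c - Coalgebra.counit (R := k) c • 1 := by
  rw [cobarOne, LinearMap.comp_apply, TensorAlgebra.ι_leftInverse, augProj_coe,
    Algebra.algebraMap_eq_smul_one]

theorem slice_cobarOne_mul_cobarOne (f : Module.Dual k C) (a b : C) :
    slice f (cobarOne k a * cobarOne k b) =
      (f b - Coalgebra.counit (R := k) b * f 1) • (a - Coalgebra.counit (R := k) a • 1) := by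
  rw [slice_apply, cobarSlice_mul_cobarOne, map_smul, Submodule.coe_smul, coe_ιInv_cobarOne]

theorem cobarOne_slice (f : Module.Dual k C) {w : Cobar k C} (hw : w ∈ cobarDegree k C 2) :
    cobarOne k (slice f w) = cobarSlice f w := by
  suffices ∀ a b : C, (cobarOne k ∘ₗ slice f) (cobarOne k a * cobarOne k b) =
    cobarSlice f (cobarOne k a * cobarOne k b) from cobarDegree_two_ext this hw
  intro a b
  simp [slice_cobarOne_mul_cobarOne, cobarSlice_mul_cobarOne, cobarOne_one]

theorem slice_counit {w : Cobar k C} (hw : w ∈ cobarDegree k C 2) :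
    slice (Coalgebra.counit (R := k) (A := C)) w = 0 :=
  cobarDegree_two_ext (ψ := 0) (by simp [slice_cobarOne_mul_cobarOne]) hw

theorem counit_slice (f : Module.Dual k C) (w : Cobar k C) :
    Coalgebra.counit (R := k) (slice f w) = 0 :=
  (TensorAlgebra.ιInv (cobarSlice f w)).2

theorem eq_zero_of_slice_eq_zero {w : Cobar k C} (hw : w ∈ cobarDegree k C 2)
    (h : ∀ f : Module.Dual k C, slice f w = 0) : w = 0 := by
  have hsplit : splitLast w = 0 := by
    refine eq_zero_of_contractRight_eq_zero fun f => ?_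
    have hf : (f ∘ₗ augProj k) ∘ₗ (augKer k C).subtype = f := by
      ext c; simp [augProj_of_mem k c.2]
    calc contractRight f (splitLast w)
      _ = cobarSlice (f ∘ₗ augProj k) w := by
          rw [cobarSlice, LinearMap.comp_apply, LinearMap.comp_apply, LinearMap.lcomp_apply',
            LinearMap.lcomp_apply', hf]
          rfl
      _ = 0 := by rw [← cobarOne_slice _ hw, h, map_zero]
  have hjoin : (LinearMap.mul' k (Cobar k C) ∘ₗ
      (TensorAlgebra.ι k).lTensor (Cobar k C) ∘ₗ splitLast) w = LinearMap.id w :=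
    cobarDegree_two_ext (fun a b => by simp [cobarOne]) hw
  simpa [hsplit] using hjoin.symm

theorem cobarSlice_mul_cobarDifferential_cobarOne {f : Module.Dual k C} (hf : f 1 = 0)
    (a : Cobar k C) (c : C) :
    cobarSlice f (a * cobarDifferential k C (cobarOne k c)) = a * cobarOne k (hit f c) := by
  rw [cobarDifferential_cobarOne, hit_apply]
  induction Coalgebra.comul (R := k) c with
  | zero => simp
  | add s t hs ht => simp only [map_add, mul_add, hs, ht]
  | tmul b c => simp [← mul_assoc, cobarSlice_mul_cobarOne, hf]

theorem slice_cobarDifferential_cobarOne {f : Module.Dual k C} (hf : f 1 = 0) (c : C) :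
    slice f (cobarDifferential k C (cobarOne k c)) = hit f c - f c • 1 := by
  rw [slice_apply, ← one_mul (cobarDifferential k C _),
    cobarSlice_mul_cobarDifferential_cobarOne hf, one_mul, coe_ιInv_cobarOne, counit_hit]

theorem cobarSlice_cobarSlice_cobarDifferential {f g : Module.Dual k C} (hf : f 1 = 0)
    (hg : g 1 = 0) {w : Cobar k C} (hw : w ∈ cobarDegree k C 2) :
    cobarSlice f (cobarSlice g (cobarDifferential k C w)) =
      cobarSlice f (cobarDifferential k C (cobarSlice g w)) - cobarSlice (f ∘ₗ hit g) w := by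
  suffices ∀ a b : C,
      (cobarSlice f ∘ₗ cobarSlice g ∘ₗ cobarDifferential k C) (cobarOne k a * cobarOne k b) =
        (cobarSlice f ∘ₗ cobarDifferential k C ∘ₗ cobarSlice g - cobarSlice (f ∘ₗ hit g))
          (cobarOne k a * cobarOne k b) from cobarDegree_two_ext this hw
  intro a b
  simp [cobarDifferential_mul k (cobarOne_mem k a), cobarSlice_mul_cobarOne,
    cobarSlice_mul_cobarDifferential_cobarOne, hit_one, hf, hg, sub_eq_add_neg]

theorem slice_comp_hit {f g : Module.Dual k C} (hf : f 1 = 0) (hg : g 1 = 0) {w : Cobar k C}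
    (hw : w ∈ cobarCocycles k C 2) :
    slice (f ∘ₗ hit g) w = hit f (slice g w) - f (slice g w) • 1 := by
  have h := cobarSlice_cobarSlice_cobarDifferential hf hg hw.1
  rw [LinearMap.mem_ker.1 hw.2, map_zero, map_zero, eq_comm, sub_eq_zero, ← cobarOne_slice g hw.1]
    at h
  rw [slice_apply, ← h, ← slice_apply, slice_cobarDifferential_cobarOne hf]

end Slice

section Cocycles

variable {k C : Type*} [Field k] [Ring C] [HopfAlgebra k C]

theorem cobarDifferential_cobarOne_mem (c : C) :
    cobarDifferential k C (cobarOne k c) ∈ cobarCocycles k C 2 := by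
  refine ⟨?_, cobarDifferential_sq k _⟩
  rw [cobarDifferential_cobarOne]
  induction Coalgebra.comul (R := k) c with
  | zero => simp
  | add s t hs ht => rw [map_add]; exact add_mem hs ht
  | tmul a b => exact cobarOne_mul_cobarOne_mem k a b

theorem mem_cobarCoboundaries_two {w : Cobar k C} :
    w ∈ cobarCoboundaries k C 2 ↔ ∃ c : C, cobarDifferential k C (cobarOne k c) = w := by
  constructor
  · rintro ⟨v, hv, rfl⟩
    rw [SetLike.mem_coe, cobarDegree, pow_one] at hv
    obtain ⟨c, rfl⟩ := hv
    exact ⟨c, by rw [cobarOne_of_mem k c.2]⟩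
  · rintro ⟨c, rfl⟩
    exact ⟨_, cobarOne_mem k c, rfl⟩

theorem cobarDifferential_cobarOne_of_isPrimitiveElt {p : C} (hp : IsPrimitiveElt k p) :
    cobarDifferential k C (cobarOne k p) = 0 := by
  rw [cobarDifferential_cobarOne, hp]
  simp [cobarOne_one]

section Generators

variable {x y z : C} (hx : IsPrimitiveElt k x) (hy : IsPrimitiveElt k y)

include hx hy in
theorem comul_mul_of_isPrimitiveElt : Coalgebra.comul (R := k) (x * y) =
    (x * y) ⊗ₜ[k] 1 + x ⊗ₜ[k] y + y ⊗ₜ[k] x + 1 ⊗ₜ[k] (x * y) := by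
  rw [Bialgebra.comul_mul, hx, hy]
  simp only [add_mul, mul_add, Algebra.TensorProduct.tmul_mul_tmul, one_mul, mul_one]
  abel

include hx hy in
theorem cobarDifferential_cobarOne_mul_of_isPrimitiveElt :
    cobarDifferential k C (cobarOne k (x * y)) =
      cobarOne k x * cobarOne k y + cobarOne k y * cobarOne k x := by
  rw [cobarDifferential_cobarOne, comul_mul_of_isPrimitiveElt hx hy]
  simp [cobarOne_one]

variable (hz : Coalgebra.comul (R := k) z = 1 ⊗ₜ[k] z + x ⊗ₜ[k] y - y ⊗ₜ[k] x + z ⊗ₜ[k] 1)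

include hz in
theorem cobarDifferential_cobarOne_z : cobarDifferential k C (cobarOne k z) =
    cobarOne k x * cobarOne k y - cobarOne k y * cobarOne k x := by
  rw [cobarDifferential_cobarOne, hz]
  simp [cobarOne_one]

include hx hy hz

theorem cobarU_mem_cobarCocycles : cobarU k x y z ∈ cobarCocycles k C 2 := by
  refine ⟨add_mem (add_mem (sub_mem ?_ ?_) ?_) ?_, LinearMap.mem_ker.2 ?_⟩
  iterate 4 exact cobarOne_mul_cobarOne_mem k _ _
  simp only [cobarU, map_add, map_sub, cobarDifferential_mul k (cobarOne_mem k _),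
    cobarDifferential_cobarOne_of_isPrimitiveElt hx, cobarDifferential_cobarOne_z hz,
    cobarDifferential_cobarOne_mul_of_isPrimitiveElt hx hy]
  noncomm_ring

theorem cobarT_mem_cobarCocycles : cobarT k x y z ∈ cobarCocycles k C 2 := by
  refine ⟨add_mem (add_mem (sub_mem ?_ ?_) ?_) ?_, LinearMap.mem_ker.2 ?_⟩
  iterate 4 exact cobarOne_mul_cobarOne_mem k _ _
  simp only [cobarT, map_add, map_sub, cobarDifferential_mul k (cobarOne_mem k _),
    cobarDifferential_cobarOne_of_isPrimitiveElt hy, cobarDifferential_cobarOne_z hz,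
    cobarDifferential_cobarOne_mul_of_isPrimitiveElt hx hy]
  noncomm_ring

end Generators

end Cocycles

section Obstruction

variable {k C : Type*} [Field k] [Ring C] [HopfAlgebra k C]

/-- The scalar that prevents the slices of a two-cocycle by `ξ`, `η` and `f` from satisfying the
integrability condition of `ThinTriple.exists_hit_sub_mem`. -/
def obstruction (ξ η f : Module.Dual k C) : Cobar k C →ₗ[k] k :=
  f ∘ₗ slice (dualLie ξ η) - dualLie ξ η ∘ₗ slice f

theorem obstruction_apply (ξ η f : Module.Dual k C) (w : Cobar k C) :
    obstruction ξ η f w = f (slice (dualLie ξ η) w) - dualLie ξ η (slice f w) := rfl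

variable {ξ η f : Module.Dual k C}

theorem hit_sub_hit_dualLie_slice (hξ : ξ 1 = 0) (hη : η 1 = 0) (hf : f 1 = 0) {w : Cobar k C}
    (hw : w ∈ cobarCocycles k C 2) :
    hit f (hit ξ (slice η w) - hit η (slice ξ w)) - hit (dualLie ξ η) (slice f w) =
      slice (dualLie f (dualLie ξ η)) w + obstruction ξ η f w • 1 := by
  have slice_dualLie {p q : Module.Dual k C} (hp : p 1 = 0) (hq : q 1 = 0) :
      slice (dualLie p q) w =
        hit p (slice q w) - hit q (slice p w) - (p (slice q w) - q (slice p w)) • 1 := by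
    rw [dualLie, map_sub, LinearMap.sub_apply, slice_comp_hit hp hq hw, slice_comp_hit hq hp hw,
      sub_smul]
    abel
  have hζ := dualLie_apply_one hξ hη
  rw [slice_dualLie hf hζ, obstruction_apply, sub_add_cancel, slice_dualLie hξ hη]
  simp only [map_sub, map_smul, hit_one, hf, zero_smul, smul_zero, sub_zero]

theorem obstruction_cobarDifferential_cobarOne (hξ : ξ 1 = 0) (hη : η 1 = 0) (hf : f 1 = 0)
    (c : C) : obstruction ξ η f (cobarDifferential k C (cobarOne k c)) =
      dualLie f (dualLie ξ η) c := by
  have hζ := dualLie_apply_one hξ hη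
  simp [obstruction_apply, slice_cobarDifferential_cobarOne, hf, hζ, dualLie_apply f]

end Obstruction

namespace ThinTriple

variable {k C : Type*} [Field k] [Ring C] [HopfAlgebra k C] {x y z : C} {ξ η : Module.Dual k C}

section Values

variable (T : ThinTriple k x y z ξ η)
include T

theorem counit_z : Coalgebra.counit (R := k) z = 0 := by
  have h := counit_hit (k := k) Coalgebra.counit z
  rw [T.hit_z] at h
  simpa [counit_of_isPrimitiveElt T.primitive_x, counit_of_isPrimitiveElt T.primitive_y] using h

theorem slice_cobarU {f : Module.Dual k C} (hf : f 1 = 0) :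
    slice f (cobarU k x y z) = f x • z - f z • x + f x • (x * y) + f (x * y) • x := by
  simp [cobarU, slice_cobarOne_mul_cobarOne, hf, counit_of_isPrimitiveElt T.primitive_x, T.counit_z]

theorem slice_cobarT {f : Module.Dual k C} (hf : f 1 = 0) :
    slice f (cobarT k x y z) = f z • y - f y • z + f y • (x * y) + f (x * y) • y := by
  simp [cobarT, slice_cobarOne_mul_cobarOne, hf, counit_of_isPrimitiveElt T.primitive_x,
    counit_of_isPrimitiveElt T.primitive_y, T.counit_z]

theorem dualLie_mul : dualLie ξ η (x * y) = 0 := by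
  simp [dualLie_apply, hit_apply, comul_mul_of_isPrimitiveElt T.primitive_x T.primitive_y,
    T.ξ_one, T.ξ_x, T.ξ_y, T.η_one, T.η_x, T.η_y]

theorem obstruction_cobarU {f : Module.Dual k C} (hf : f 1 = 0) :
    obstruction ξ η f (cobarU k x y z) = -4 * f x := by
  rw [obstruction_apply, T.slice_cobarU hf, T.slice_cobarU T.dualLie_one]
  simp only [map_add, map_sub, map_smul, smul_eq_mul, T.dualLie_x, T.dualLie_z, T.dualLie_mul]
  ring

theorem obstruction_cobarT {f : Module.Dual k C} (hf : f 1 = 0) :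
    obstruction ξ η f (cobarT k x y z) = 4 * f y := by
  rw [obstruction_apply, T.slice_cobarT hf, T.slice_cobarT T.dualLie_one]
  simp only [map_add, map_sub, map_smul, smul_eq_mul, T.dualLie_y, T.dualLie_z, T.dualLie_mul]
  ring

theorem dualLie_dualLie_eq_zero {f : Module.Dual k C} (hf : f 1 = 0) {c : C}
    (hc : c ∈ thinFil k x y z 3) : dualLie f (dualLie ξ η) c = 0 := by
  rw [← counit_hit, hit_dualLie, eq_zero_of_mem_thinFil (by lia) (T.lie_hit_hit_dualLie_mem hf hc),
    map_zero]

end Values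

end ThinTriple

section CocycleFiltration

variable {k C : Type*} [Field k] [Ring C] [HopfAlgebra k C] {x y z : C} {ξ η : Module.Dual k C}

variable (k x y z ξ η) in
/-- The two-cocycles whose slices by `ξ` and `η` have weight at most `n`. -/
def cocycleFil (n : ℤ) : Submodule k (Cobar k C) :=
  cobarCocycles k C 2 ⊓
    ((thinFil k x y z n).comap (slice ξ) ⊓ (thinFil k x y z n).comap (slice η))

theorem mem_cocycleFil {n : ℤ} {w : Cobar k C} :
    w ∈ cocycleFil k x y z ξ η n ↔ w ∈ cobarCocycles k C 2 ∧
      slice ξ w ∈ thinFil k x y z n ∧ slice η w ∈ thinFil k x y z n := Iff.rfl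

namespace ThinTriple

variable (T : ThinTriple k x y z ξ η)
include T

theorem exists_mem_cocycleFil {w : Cobar k C} (hw : w ∈ cobarCocycles k C 2) :
    ∃ n ≥ 2, w ∈ cocycleFil k x y z ξ η n := by
  obtain ⟨i, hi⟩ := T.exists_mem_thinFil (slice ξ w)
  obtain ⟨j, hj⟩ := T.exists_mem_thinFil (slice η w)
  exact ⟨max 2 (max i j), le_max_left _ _, hw, monotone_thinFil (by lia) hi,
    monotone_thinFil (by lia) hj⟩

theorem cobarU_mem_cocycleFil : cobarU k x y z ∈ cocycleFil k x y z ξ η 2 := by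
  have hxy : x * y ∈ thinFil k x y z 2 :=
    monotone_thinFil (by lia) (SetLike.mul_mem_graded x_mem_thinFil y_mem_thinFil)
  have hx : x ∈ thinFil k x y z 2 := monotone_thinFil (by lia) x_mem_thinFil
  have slice_mem {f : Module.Dual k C} (hf : f 1 = 0) :
      slice f (cobarU k x y z) ∈ thinFil k x y z 2 := by
    rw [T.slice_cobarU hf]
    exact add_mem (add_mem (sub_mem (Submodule.smul_mem _ _ z_mem_thinFil)
      (Submodule.smul_mem _ _ hx)) (Submodule.smul_mem _ _ hxy)) (Submodule.smul_mem _ _ hx)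
  exact ⟨cobarU_mem_cobarCocycles T.primitive_x T.primitive_y T.comul_z, slice_mem T.ξ_one,
    slice_mem T.η_one⟩

theorem cobarT_mem_cocycleFil : cobarT k x y z ∈ cocycleFil k x y z ξ η 2 := by
  have hxy : x * y ∈ thinFil k x y z 2 :=
    monotone_thinFil (by lia) (SetLike.mul_mem_graded x_mem_thinFil y_mem_thinFil)
  have hy : y ∈ thinFil k x y z 2 := monotone_thinFil (by lia) y_mem_thinFil
  have slice_mem {f : Module.Dual k C} (hf : f 1 = 0) :
      slice f (cobarT k x y z) ∈ thinFil k x y z 2 := by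
    rw [T.slice_cobarT hf]
    exact add_mem (add_mem (sub_mem (Submodule.smul_mem _ _ hy)
      (Submodule.smul_mem _ _ z_mem_thinFil)) (Submodule.smul_mem _ _ hxy))
      (Submodule.smul_mem _ _ hy)
  exact ⟨cobarT_mem_cobarCocycles T.primitive_x T.primitive_y T.comul_z, slice_mem T.ξ_one,
    slice_mem T.η_one⟩

theorem obstruction_smul_cobarU_add_smul_cobarT (a b : k) {f : Module.Dual k C} (hf : f 1 = 0) :
    obstruction ξ η f (a • cobarU k x y z + b • cobarT k x y z) = 4 * (b * f y - a * f x) := by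
  rw [map_add, map_smul, map_smul, T.obstruction_cobarU hf, T.obstruction_cobarT hf, smul_eq_mul,
    smul_eq_mul]
  ring

variable [CharZero k]

theorem slice_mem_thinFil {m n : ℤ} (hm : 0 ≤ m) {h : Module.Dual k C}
    (hh : ∀ a ∈ thinFil k x y z (m + 1), h a = 0) {w : Cobar k C}
    (hw : w ∈ cocycleFil k x y z ξ η n) : slice h w ∈ thinFil k x y z (n - m - 1) := by
  obtain ⟨p, q, hp, hq, rfl⟩ := exists_eq_comp_add_comp (hit ξ) (hit η) (thinFil k x y z m)
    fun c hξ hη => hh c <| T.mem_of_hit_mem (by lia) (by simpa using hξ) (by simpa using hη)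
  obtain ⟨hw, hwξ, hwη⟩ := mem_cocycleFil.1 hw
  have slice_comp_hit_mem {p f : Module.Dual k C} (hp : ∀ a ∈ thinFil k x y z m, p a = 0)
      (hf : f 1 = 0) (hwf : slice f w ∈ thinFil k x y z n) :
      slice (p ∘ₗ hit f) w ∈ thinFil k x y z (n - m - 1) := by
    rw [slice_comp_hit (hp 1 (one_mem_thinFil hm)) hf hw]
    refine sub_mem (T.hit_mem hp hwf) ?_
    obtain hn | hn := le_or_gt n m
    · simp [hp _ (monotone_thinFil hn hwf)]
    · exact Submodule.smul_mem _ _ (one_mem_thinFil (by lia))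
  rw [map_add, LinearMap.add_apply]
  exact add_mem (slice_comp_hit_mem hp T.ξ_one hwξ) (slice_comp_hit_mem hq T.η_one hwη)

theorem eq_zero_of_mem_cocycleFil_zero {w : Cobar k C} (hw : w ∈ cocycleFil k x y z ξ η 0) :
    w = 0 := by
  have eq_zero_of_mem {f : Module.Dual k C} (hf : slice f w ∈ thinFil k x y z 0) :
      slice f w = 0 := by
    obtain ⟨r, hr⟩ := Submodule.mem_one.1 (thinFil_zero_le hf)
    have hr0 : r = 0 := by
      rw [← counit_slice f w, ← hr, Bialgebra.counit_algebraMap]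
    rw [← hr, hr0, map_zero]
  refine eq_zero_of_slice_eq_zero hw.1.1 fun f => ?_
  set h := f - f 1 • Coalgebra.counit (R := k) - f x • ξ - f y • η with h_def
  have hh : slice h w = 0 := by
    refine eq_zero_of_mem_thinFil (by lia) (T.slice_mem_thinFil le_rfl (fun a ha => ?_) hw)
    refine apply_eq_zero_of_mem_thinFil_one ?_ ?_ ?_ ha
    · simp [h, T.ξ_one, T.η_one]
    · simp [h, T.ξ_x, T.η_x, counit_of_isPrimitiveElt T.primitive_x]
    · simp [h, T.ξ_y, T.η_y, counit_of_isPrimitiveElt T.primitive_y]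
  simpa [h_def, slice_counit hw.1.1, eq_zero_of_mem hw.2.1, eq_zero_of_mem hw.2.2] using hh

theorem exists_sub_cobarDifferential_mem_cocycleFil {n : ℤ} (hn : 1 ≤ n) {w : Cobar k C}
    (hw : w ∈ cocycleFil k x y z ξ η n)
    (hob : n < 3 → obstruction ξ η ξ w = 0 ∧ obstruction ξ η η w = 0) :
    ∃ c ∈ thinFil k x y z (n + 1),
      w - cobarDifferential k C (cobarOne k c) ∈ cocycleFil k x y z ξ η (n - 1) := by
  have integrable {f : Module.Dual k C} (hf : f 1 = 0) (hfw : n < 3 → obstruction ξ η f w = 0) :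
      hit f (hit ξ (slice η w) - hit η (slice ξ w)) - hit (dualLie ξ η) (slice f w) ∈
        thinFil k x y z (n + 1 - 4) := by
    rw [hit_sub_hit_dualLie_slice T.ξ_one T.η_one hf hw.1]
    refine add_mem (monotone_thinFil (by lia) (T.slice_mem_thinFil (m := 2) (by lia)
      (fun c hc => T.dualLie_dualLie_eq_zero hf hc) hw)) ?_
    obtain hn | hn := lt_or_ge n 3
    · simp [hfw hn]
    · exact Submodule.smul_mem _ _ (one_mem_thinFil (by lia))
  obtain ⟨c, hc, hξ, hη⟩ := T.exists_hit_sub_mem (n := n + 1) (by lia)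
    (by simpa using hw.2.1) (by simpa using hw.2.2)
    (integrable T.ξ_one fun h => (hob h).1) (integrable T.η_one fun h => (hob h).2)
  have slice_sub_mem {f : Module.Dual k C} (hf : f 1 = 0)
      (hfc : hit f c - slice f w ∈ thinFil k x y z (n + 1 - 2)) :
      slice f (w - cobarDifferential k C (cobarOne k c)) ∈ thinFil k x y z (n - 1) := by
    rw [map_sub, slice_cobarDifferential_cobarOne hf, ← sub_add, ← neg_sub (hit f c)]
    exact add_mem (monotone_thinFil (by lia) (neg_mem hfc))
      (Submodule.smul_mem _ _ (one_mem_thinFil (by lia)))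
  exact ⟨c, hc, sub_mem hw.1 (cobarDifferential_cobarOne_mem c), slice_sub_mem T.ξ_one hξ,
    slice_sub_mem T.η_one hη⟩

theorem mem_cobarCoboundaries_of_obstruction_eq_zero {w : Cobar k C}
    (hw : w ∈ cocycleFil k x y z ξ η 2) (hξ : obstruction ξ η ξ w = 0)
    (hη : obstruction ξ η η w = 0) : w ∈ cobarCoboundaries k C 2 := by
  suffices ∀ n : ℤ, 0 ≤ n → n ≤ 2 → ∀ w ∈ cocycleFil k x y z ξ η n, obstruction ξ η ξ w = 0 →
    obstruction ξ η η w = 0 → w ∈ cobarCoboundaries k C 2 from this 2 (by lia) le_rfl w hw hξ hη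
  intro n hn
  induction n, hn using Int.leInduction with
  | base =>
    intro _ w hw _ _
    exact T.eq_zero_of_mem_cocycleFil_zero hw ▸ zero_mem _
  | succ n hn ih =>
    intro hn2 w hw hξ hη
    obtain ⟨c, hc, hwc⟩ := T.exists_sub_cobarDifferential_mem_cocycleFil (by lia) hw
      fun _ => ⟨hξ, hη⟩
    have obstruction_sub {f : Module.Dual k C} (hf : f 1 = 0) (hfw : obstruction ξ η f w = 0) :
        obstruction ξ η f (w - cobarDifferential k C (cobarOne k c)) = 0 := by
      rw [map_sub, hfw, obstruction_cobarDifferential_cobarOne T.ξ_one T.η_one hf,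
        T.dualLie_dualLie_eq_zero hf (monotone_thinFil (by lia) hc), sub_zero]
    rw [add_sub_cancel_right] at hwc
    have h := ih (by lia) _ hwc (obstruction_sub T.ξ_one hξ) (obstruction_sub T.η_one hη)
    exact (Submodule.sub_mem_iff_left _ (mem_cobarCoboundaries_two.2 ⟨c, rfl⟩)).1 h

theorem cobarCocycles_le_cocycleFil_sup :
    cobarCocycles k C 2 ≤ cocycleFil k x y z ξ η 2 ⊔ cobarCoboundaries k C 2 := by
  intro w hw
  obtain ⟨n, hn, hwn⟩ := T.exists_mem_cocycleFil hw
  clear hw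
  induction n, hn using Int.leInduction generalizing w with
  | base => exact Submodule.mem_sup_left hwn
  | succ n hn ih =>
    obtain ⟨c, -, hwc⟩ := T.exists_sub_cobarDifferential_mem_cocycleFil (by lia) hwn
      fun h => absurd h (by lia)
    rw [add_sub_cancel_right] at hwc
    exact (Submodule.sub_mem_iff_left _ (Submodule.mem_sup_right
      (mem_cobarCoboundaries_two.2 ⟨c, rfl⟩))).1 (ih hwc)

theorem cobarCocycles_le_span_sup :
    cobarCocycles k C 2 ≤
      Submodule.span k {cobarU k x y z, cobarT k x y z} ⊔ cobarCoboundaries k C 2 := by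
  refine T.cobarCocycles_le_cocycleFil_sup.trans (sup_le (fun w hw => ?_) le_sup_right)
  let s := (-(obstruction ξ η ξ w / 4)) • cobarU k x y z +
    (obstruction ξ η η w / 4) • cobarT k x y z
  have hs : s ∈ cocycleFil k x y z ξ η 2 := add_mem (Submodule.smul_mem _ _ T.cobarU_mem_cocycleFil)
    (Submodule.smul_mem _ _ T.cobarT_mem_cocycleFil)
  have hws : w - s ∈ cobarCoboundaries k C 2 := by
    refine T.mem_cobarCoboundaries_of_obstruction_eq_zero (sub_mem hw hs) ?_ ?_
    · rw [map_sub, T.obstruction_smul_cobarU_add_smul_cobarT _ _ T.ξ_one, T.ξ_x, T.ξ_y]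
      ring
    · rw [map_sub, T.obstruction_smul_cobarU_add_smul_cobarT _ _ T.η_one, T.η_x, T.η_y]
      ring
  exact Submodule.mem_sup.2 ⟨s, Submodule.mem_span_pair.2 ⟨_, _, rfl⟩, w - s, hws,
    add_sub_cancel s w⟩

theorem eq_zero_of_smul_add_smul_mem_cobarCoboundaries {a b : k}
    (h : a • cobarU k x y z + b • cobarT k x y z ∈ cobarCoboundaries k C 2) : a = 0 ∧ b = 0 := by
  obtain ⟨c, hc⟩ := mem_cobarCoboundaries_two.1 h
  have hmem : cobarDifferential k C (cobarOne k c) ∈ cocycleFil k x y z ξ η 2 :=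
    hc ▸ add_mem (Submodule.smul_mem _ _ T.cobarU_mem_cocycleFil)
      (Submodule.smul_mem _ _ T.cobarT_mem_cocycleFil)
  have hit_mem {f : Module.Dual k C} (hf : f 1 = 0)
      (hfc : slice f (cobarDifferential k C (cobarOne k c)) ∈ thinFil k x y z 2) :
      hit f c ∈ thinFil k x y z (3 - 1) := by
    rw [slice_cobarDifferential_cobarOne hf] at hfc
    exact (Submodule.sub_mem_iff_left _ (Submodule.smul_mem _ _ (one_mem_thinFil (by lia)))).1 hfc
  have hc3 : c ∈ thinFil k x y z 3 :=
    T.mem_of_hit_mem (by lia) (hit_mem T.ξ_one hmem.2.1) (hit_mem T.η_one hmem.2.2)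
  have obstruction_eq_zero {f : Module.Dual k C} (hf : f 1 = 0) : b * f y - a * f x = 0 := by
    have hob := obstruction_cobarDifferential_cobarOne T.ξ_one T.η_one hf c
    rw [hc, T.obstruction_smul_cobarU_add_smul_cobarT a b hf, T.dualLie_dualLie_eq_zero hf hc3]
      at hob
    exact (mul_eq_zero.1 hob).resolve_left (by norm_num)
  have hξ := obstruction_eq_zero T.ξ_one
  have hη := obstruction_eq_zero T.η_one
  rw [T.ξ_x, T.ξ_y] at hξ
  rw [T.η_x, T.η_y] at hη
  exact ⟨by linear_combination -hξ, by linear_combination hη⟩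

end ThinTriple

end CocycleFiltration

section Cohomology

variable {k C : Type*} [Field k] [Ring C] [HopfAlgebra k C] {n : ℕ} {a b : Cobar k C}
  (ha : a ∈ cobarCocycles k C n) (hb : b ∈ cobarCocycles k C n)

theorem smul_cobarClass_add_smul_cobarClass_eq_mk (r s : k) :
    r • cobarClass k a ha + s • cobarClass k b hb = Submodule.Quotient.mk
      ⟨r • a + s • b, add_mem (Submodule.smul_mem _ r ha) (Submodule.smul_mem _ s hb)⟩ := rfl

theorem span_cobarClass_pair_eq_top
    (h : cobarCocycles k C n ≤ Submodule.span k {a, b} ⊔ cobarCoboundaries k C n) :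
    Submodule.span k {cobarClass k a ha, cobarClass k b hb} = ⊤ := by
  refine eq_top_iff.2 fun c _ => ?_
  obtain ⟨⟨w, hw⟩, rfl⟩ := Submodule.Quotient.mk_surjective _ c
  obtain ⟨s, hs, v, hv, rfl⟩ := Submodule.mem_sup.1 (h hw)
  obtain ⟨r, r', rfl⟩ := Submodule.mem_span_pair.1 hs
  refine Submodule.mem_span_pair.2 ⟨r, r', ?_⟩
  rw [smul_cobarClass_add_smul_cobarClass_eq_mk, eq_comm, Submodule.Quotient.eq]
  simpa [Submodule.submoduleOf] using hv

theorem linearIndependent_cobarClass_pair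
    (h : ∀ r s : k, r • a + s • b ∈ cobarCoboundaries k C n → r = 0 ∧ s = 0) :
    LinearIndependent k ![cobarClass k a ha, cobarClass k b hb] := by
  refine LinearIndependent.pair_iff.2 fun r s hrs => h r s ?_
  rwa [smul_cobarClass_add_smul_cobarClass_eq_mk, Submodule.Quotient.mk_eq_zero] at hrs

end Cohomology

theorem finrank_eq_two_of_span_pair_eq_top {k V : Type*} [DivisionRing k] [AddCommGroup V]
    [Module k V] {v w : V} (hli : LinearIndependent k ![v, w])
    (hspan : Submodule.span k {v, w} = ⊤) : Module.finrank k V = 2 := by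
  rw [← finrank_top, ← hspan, ← Matrix.range_cons_cons_empty, finrank_span_eq_card hli,
    Fintype.card_fin]

section Growth

variable {k A : Type*} [Field k] [Ring A] [Algebra k A]

theorem log_div_log_le {r d n N : ℕ} (hn : 2 ≤ n) (hN : N ≤ (d * n + 1) ^ r) :
    Real.log N / Real.log n ≤ r * Real.log (d + 1) / Real.log n + r := by
  have hlogn : 0 < Real.log n := Real.log_pos (by exact_mod_cast hn)
  have hn0 : (n : ℝ) ≠ 0 := by positivity
  have hd0 : (d + 1 : ℝ) ≠ 0 := by positivity
  have hlogN : Real.log N ≤ Real.log (((d + 1) * n) ^ r) := by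
    obtain rfl | hN0 := N.eq_zero_or_pos
    · rw [Nat.cast_zero, Real.log_zero]
      exact_mod_cast Real.log_natCast_nonneg (((d + 1) * n) ^ r)
    · refine Real.log_le_log (by exact_mod_cast hN0) ?_
      exact_mod_cast hN.trans (Nat.pow_le_pow_left (by lia) r)
  rw [Real.log_pow, Real.log_mul hd0 hn0] at hlogN
  rwa [div_le_iff₀ hlogn, add_mul, div_mul_cancel₀ _ hlogn.ne', ← mul_add]

theorem pow_le_of_le {F : ℕ → Submodule k A} [SetLike.GradedMonoid F] {W : Submodule k A} {d : ℕ}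
    (hW : W ≤ F d) (n : ℕ) : W ^ n ≤ F (d * n) := by
  induction n with
  | zero => exact Submodule.one_le.2 (SetLike.one_mem_graded F)
  | succ n ih =>
    rw [pow_succ, Submodule.mul_le]
    exact fun a ha b hb => SetLike.mul_mem_graded (ih ha) (hW hb)

theorem exists_fg_le_of_monotone {F : ℕ → Submodule k A} (hF : Monotone F)
    (hexh : ∀ a, ∃ n, a ∈ F n) {V : Submodule k A} (hV : V.FG) : ∃ d, V ≤ F d := by
  obtain ⟨s, rfl⟩ := hV
  choose N hN using hexh
  exact ⟨s.sup N, Submodule.span_le.2 fun a ha => hF (Finset.le_sup (f := N) ha) (hN a)⟩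

theorem gkDim_le_of_finrank_le_pow {F : ℕ → Submodule k A} [SetLike.GradedMonoid F]
    [∀ n, FiniteDimensional k (F n)] (hF : Monotone F) (hexh : ∀ a, ∃ n, a ∈ F n) {r : ℕ}
    (hrank : ∀ n, Module.finrank k (F n) ≤ (n + 1) ^ r) : gkDim k A ≤ r := by
  refine iSup₂_le fun V _ => ?_
  have hV : (1 ⊔ V).FG := by
    rw [Submodule.one_eq_span]
    exact (Submodule.fg_span_singleton _).sup ((Submodule.fg_iff_finiteDimensional V).2 ‹_›)
  obtain ⟨d, hd⟩ := exists_fg_le_of_monotone hF hexh hV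
  have hlim : Filter.Tendsto (fun n : ℕ => ((r * Real.log (d + 1) / Real.log n + r : ℝ) : EReal))
      Filter.atTop (nhds ((0 + r : ℝ) : EReal)) :=
    (continuous_coe_real_ereal.tendsto _).comp <| ((Real.tendsto_log_atTop.comp
      tendsto_natCast_atTop_atTop).const_div_atTop _).add_const _
  rw [← EReal.coe_natCast, ← zero_add (r : ℝ), ← hlim.limsup_eq]
  refine Filter.limsup_le_limsup ?_
  filter_upwards [Filter.eventually_ge_atTop 2] with n hn
  exact EReal.coe_le_coe (log_div_log_le hn
    ((Submodule.finrank_mono (pow_le_of_le hd n)).trans (hrank _)))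

theorem pow_mul_pow_le_pow_mul_pow {α : Type*} [Monoid α] [Preorder α] [MulLeftMono α]
    [MulRightMono α] {a b : α} (h : b * a ≤ a * b) (m n : ℕ) : b ^ m * a ^ n ≤ a ^ n * b ^ m := by
  have mul_pow_le (n : ℕ) : b * a ^ n ≤ a ^ n * b := by
    induction n with
    | zero => simp
    | succ n ih =>
      calc b * a ^ (n + 1) = b * a ^ n * a := by rw [pow_succ, mul_assoc]
        _ ≤ a ^ n * b * a := by gcongr
        _ = a ^ n * (b * a) := mul_assoc _ _ _
        _ ≤ a ^ n * (a * b) := by gcongr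
        _ = a ^ (n + 1) * b := by rw [pow_succ, mul_assoc]
  induction m with
  | zero => simp
  | succ m ih =>
    calc b ^ (m + 1) * a ^ n = b ^ m * (b * a ^ n) := by rw [pow_succ, mul_assoc]
      _ ≤ b ^ m * (a ^ n * b) := mul_le_mul_right (mul_pow_le n) _
      _ = b ^ m * a ^ n * b := (mul_assoc _ _ _).symm
      _ ≤ a ^ n * b ^ m * b := by gcongr
      _ = a ^ n * b ^ (m + 1) := by rw [pow_succ, mul_assoc]

theorem finrank_mul_le (M N : Submodule k A) [FiniteDimensional k M] [FiniteDimensional k N] :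
    Module.finrank k ↥(M * N) ≤ Module.finrank k M * Module.finrank k N := by
  rw [← Submodule.mulMap_range, ← Module.finrank_tensorProduct]
  exact LinearMap.finrank_range_le _

theorem span_one_pair_pow_le (p : A) (n : ℕ) :
    Submodule.span k {1, p} ^ n ≤
      Submodule.span k (Set.range fun i : Fin (n + 1) => p ^ (i : ℕ)) := by
  induction n with
  | zero => simp [Submodule.one_eq_span]
  | succ n ih =>
    rw [pow_succ]
    refine (mul_le_mul_left ih _).trans ?_
    rw [Submodule.span_mul_span]
    refine Submodule.span_mono ?_
    rintro _ ⟨_, ⟨i, rfl⟩, _, rfl | rfl, rfl⟩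
    · exact ⟨i.castSucc, by simp⟩
    · exact ⟨i.succ, by simp [pow_succ]⟩

theorem finrank_span_one_pair_pow_le (p : A) (n : ℕ) :
    Module.finrank k ↥(Submodule.span k {1, p} ^ n) ≤ n + 1 :=
  have := FiniteDimensional.span_of_finite k (Set.finite_range fun i : Fin (n + 1) => p ^ (i : ℕ))
  (Submodule.finrank_mono (span_one_pair_pow_le p n)).trans
    ((finrank_range_le_card _).trans_eq (Fintype.card_fin _))

theorem gradedMonoid_pow_mul_pow {P Q : Submodule k A} (h : Q * P ≤ P * Q) :
    SetLike.GradedMonoid fun n : ℕ => P ^ n * Q ^ n where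
  one_mem := by simpa using Submodule.one_le.1 (le_refl (1 : Submodule k A))
  mul_mem m n c d hc hd := by
    refine (?_ : P ^ m * Q ^ m * (P ^ n * Q ^ n) ≤ _) (Submodule.mul_mem_mul hc hd)
    calc P ^ m * Q ^ m * (P ^ n * Q ^ n) = P ^ m * (Q ^ m * P ^ n) * Q ^ n := by
          simp only [mul_assoc]
      _ ≤ P ^ m * (P ^ n * Q ^ m) * Q ^ n :=
          mul_le_mul_left (mul_le_mul_right (pow_mul_pow_le_pow_mul_pow h m n) _) _
      _ = P ^ (m + n) * Q ^ (m + n) := by simp only [pow_add, mul_assoc]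

variable (k) in
theorem one_mem_span_one_pair (c : A) : (1 : A) ∈ Submodule.span k {1, c} :=
  Submodule.subset_span (by simp)

variable (k) in
theorem self_mem_span_one_pair (c : A) : c ∈ Submodule.span k {1, c} :=
  Submodule.subset_span (by simp)

variable {p q : A}

theorem left_mem_span_one_pair_mul : p ∈ Submodule.span k {1, p} * Submodule.span k {1, q} := by
  simpa using Submodule.mul_mem_mul (self_mem_span_one_pair k p) (one_mem_span_one_pair k q)

theorem right_mem_span_one_pair_mul : q ∈ Submodule.span k {1, p} * Submodule.span k {1, q} := by
  simpa using Submodule.mul_mem_mul (one_mem_span_one_pair k p) (self_mem_span_one_pair k q)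

theorem span_one_pair_mul_le {a b : k} (hpq : q * p = p * q + a • p + b • q) :
    Submodule.span k {1, q} * Submodule.span k {1, p} ≤
      Submodule.span k {1, p} * Submodule.span k {1, q} := by
  rw [Submodule.span_mul_span, Submodule.span_le]
  rintro _ ⟨c, rfl | rfl, d, rfl | rfl, rfl⟩
  · simpa using Submodule.mul_mem_mul (one_mem_span_one_pair k p) (one_mem_span_one_pair k q)
  · simpa using left_mem_span_one_pair_mul
  · simpa using right_mem_span_one_pair_mul
  · simp only [hpq]
    exact add_mem (add_mem (Submodule.mul_mem_mul (self_mem_span_one_pair k _)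
      (self_mem_span_one_pair k _)) (Submodule.smul_mem _ _ left_mem_span_one_pair_mul))
      (Submodule.smul_mem _ _ right_mem_span_one_pair_mul)

theorem gkDim_le_two {a b : k} (hpq : q * p = p * q + a • p + b • q)
    (h : Algebra.adjoin k {p, q} = ⊤) : gkDim k A ≤ 2 := by
  let F (n : ℕ) : Submodule k A := Submodule.span k {1, p} ^ n * Submodule.span k {1, q} ^ n
  have : SetLike.GradedMonoid F := gradedMonoid_pow_mul_pow (span_one_pair_mul_le hpq)
  have hF : Monotone F := fun m n hmn => mul_le_mul'
    (pow_le_pow_right' (Submodule.one_le.2 (one_mem_span_one_pair k p)) hmn)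
    (pow_le_pow_right' (Submodule.one_le.2 (one_mem_span_one_pair k q)) hmn)
  have hexh (c : A) : ∃ n, c ∈ F n := by
    obtain ⟨n, hn⟩ := exists_mem_weightFil (g := ![p, q]) (by simpa [Set.pair_comm] using h)
      (1 : Fin 2 → ℕ) c
    refine ⟨n, map_mem_of_mem_weightFil (AlgHom.id k A) hF (Fin.forall_fin_two.2 ⟨?_, ?_⟩) hn⟩
    · simpa [F] using left_mem_span_one_pair_mul
    · simpa [F] using right_mem_span_one_pair_mul
  have fg_pow (c : A) (n : ℕ) : (Submodule.span k {1, c} ^ n).FG :=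
    (Submodule.fg_span (by simp)).pow n
  have finite_pow (c : A) (n : ℕ) : FiniteDimensional k ↥(Submodule.span k {1, c} ^ n) :=
    (Submodule.fg_iff_finiteDimensional _).1 (fg_pow c n)
  have (n : ℕ) : FiniteDimensional k (F n) :=
    (Submodule.fg_iff_finiteDimensional _).1 ((fg_pow p n).mul (fg_pow q n))
  refine gkDim_le_of_finrank_le_pow hF hexh fun n => (finrank_mul_le _ _).trans ?_
  rw [pow_two]
  exact mul_le_mul' (finrank_span_one_pair_pow_le p n) (finrank_span_one_pair_pow_le q n)

end Growth

section FinrankTwo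

variable {k V : Type*} [Field k] [AddCommGroup V] [Module k V] {W : Submodule k V}

theorem eq_span_pair_of_finrank_eq_two (hW : Module.finrank k W = 2) {v w : V} (hv : v ∈ W)
    (hw : w ∈ W) (hli : LinearIndependent k ![v, w]) : W = Submodule.span k {v, w} := by
  have : Module.Finite k W := Module.finite_of_finrank_pos (by lia)
  refine (Submodule.eq_of_le_of_finrank_eq (Submodule.span_le.2 ?_) ?_).symm
  · rintro _ (rfl | rfl)
    exacts [hv, hw]
  · rw [hW, ← Matrix.range_cons_cons_empty, finrank_span_eq_card hli, Fintype.card_fin]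

theorem exists_eq_span_pair_of_finrank_eq_two (hW : Module.finrank k W = 2) :
    ∃ v ∈ W, ∃ w ∈ W, W = Submodule.span k {v, w} := by
  have : Module.Finite k W := Module.finite_of_finrank_pos (by lia)
  let b := Module.finBasisOfFinrankEq k W hW
  have hb : W.subtype ∘ b = ![(b 0 : V), (b 1 : V)] := List.ofFn_inj.1 (by simp)
  exact ⟨b 0, (b 0).2, b 1, (b 1).2, eq_span_pair_of_finrank_eq_two hW (b 0).2 (b 1).2
    (hb ▸ b.linearIndependent.map' W.subtype W.ker_subtype)⟩

theorem exists_dual_apply_eq {ι : Type*} {v : ι → V} (hv : LinearIndependent k v) (r : ι → k) :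
    ∃ f : Module.Dual k V, ∀ i, f (v i) = r i := by
  obtain ⟨g, hg⟩ := (Finsupp.linearCombination k v).exists_leftInverse_of_injective
    (LinearMap.ker_eq_bot.2 hv)
  refine ⟨Finsupp.linearCombination k r ∘ₗ g, fun i => ?_⟩
  have h := LinearMap.congr_fun hg (Finsupp.single i 1)
  simp only [LinearMap.comp_apply, Finsupp.linearCombination_single, one_smul,
    LinearMap.id_apply] at h
  simp [h]

end FinrankTwo

section PrimitivelyThin

variable {k C : Type*} [Field k] [Ring C] [HopfAlgebra k C] {p q x y z : C}

theorem comul_lie_of_isPrimitiveElt (hp : IsPrimitiveElt k p) (c : C) :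
    Coalgebra.comul (R := k) ⁅p, c⁆ =
      ⁅p ⊗ₜ[k] (1 : C) + (1 : C) ⊗ₜ[k] p, Coalgebra.comul (R := k) c⁆ := by
  rw [Ring.lie_def, Ring.lie_def, map_sub, Bialgebra.comul_mul, Bialgebra.comul_mul, hp]

theorem isPrimitiveElt_lie (hp : IsPrimitiveElt k p) (hq : IsPrimitiveElt k q) :
    IsPrimitiveElt k ⁅p, q⁆ := by
  rw [IsPrimitiveElt, comul_lie_of_isPrimitiveElt hp, hq]
  simp only [Ring.lie_def, mul_add, add_mul, Algebra.TensorProduct.tmul_mul_tmul, one_mul, mul_one,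
    TensorProduct.sub_tmul, TensorProduct.tmul_sub]
  abel

/- The bracket with `p` acts on the antisymmetric part `x ⊗ y - y ⊗ x` of `Δ z` by its trace on the
span of `x` and `y`. -/
theorem isPrimitiveElt_lie_sub_smul
    (hz : Coalgebra.comul (R := k) z = 1 ⊗ₜ[k] z + x ⊗ₜ[k] y - y ⊗ₜ[k] x + z ⊗ₜ[k] 1)
    (hp : IsPrimitiveElt k p) {a b c d : k} (hx : ⁅p, x⁆ = a • x + b • y)
    (hy : ⁅p, y⁆ = c • x + d • y) : IsPrimitiveElt k (⁅p, z⁆ - (a + d) • z) := by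
  have h : Coalgebra.comul (R := k) ⁅p, z⁆ = ⁅p, z⁆ ⊗ₜ[k] 1 + 1 ⊗ₜ[k] ⁅p, z⁆ +
      (⁅p, x⁆ ⊗ₜ[k] y + x ⊗ₜ[k] ⁅p, y⁆ - (⁅p, y⁆ ⊗ₜ[k] x + y ⊗ₜ[k] ⁅p, x⁆)) := by
    rw [comul_lie_of_isPrimitiveElt hp, hz]
    simp only [Ring.lie_def, mul_add, add_mul, mul_sub, sub_mul,
      Algebra.TensorProduct.tmul_mul_tmul, one_mul, mul_one, TensorProduct.sub_tmul,
      TensorProduct.tmul_sub]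
    abel
  rw [IsPrimitiveElt, map_sub, h, map_smul, hz, hx, hy]
  simp only [TensorProduct.sub_tmul, TensorProduct.tmul_sub, TensorProduct.add_tmul,
    TensorProduct.tmul_add, ← TensorProduct.smul_tmul', TensorProduct.tmul_smul]
  module

theorem linearIndependent_of_two_lt_gkDim
    (hP : Module.finrank k (primitiveSubmodule k C) = 2) (hgk : 2 < gkDim k C)
    (hx : IsPrimitiveElt k x) (hy : IsPrimitiveElt k y)
    (hz : Coalgebra.comul (R := k) z = 1 ⊗ₜ[k] z + x ⊗ₜ[k] y - y ⊗ₜ[k] x + z ⊗ₜ[k] 1)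
    (hgen : Algebra.adjoin k {x, y, z} = ⊤) : LinearIndependent k ![x, y] := by
  by_contra hli
  have hxy : x ⊗ₜ[k] y = y ⊗ₜ[k] x := by
    obtain rfl | hx0 := eq_or_ne x 0
    · simp
    · obtain ⟨r, rfl⟩ : ∃ r : k, r • x = y := by
        simpa [LinearIndependent.pair_iff' hx0] using hli
      rw [TensorProduct.tmul_smul, TensorProduct.smul_tmul']
  have hz' : IsPrimitiveElt k z := by
    rw [IsPrimitiveElt, hz, hxy, add_sub_cancel_right, add_comm]
  obtain ⟨p, hp, q, hq, hpq⟩ := exists_eq_span_pair_of_finrank_eq_two hP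
  have mem_span {c : C} (hc : IsPrimitiveElt k c) : c ∈ Submodule.span k {p, q} := hpq ▸ hc
  obtain ⟨a, b, hab⟩ := Submodule.mem_span_pair.1 (mem_span (isPrimitiveElt_lie hq hp))
  refine hgk.not_ge (gkDim_le_two (p := p) (q := q) (a := a) (b := b) ?_ (top_le_iff.1 ?_))
  · rw [add_assoc, hab, Ring.lie_def, add_sub_cancel]
  · rw [← hgen, Algebra.adjoin_le_iff]
    rintro c (rfl | rfl | rfl)
    exacts [Algebra.span_le_adjoin k _ (mem_span hx), Algebra.span_le_adjoin k _ (mem_span hy),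
      Algebra.span_le_adjoin k _ (mem_span hz')]

theorem exists_dual_of_isPrimitiveElt (hx : IsPrimitiveElt k x) (hy : IsPrimitiveElt k y)
    (hli : LinearIndependent k ![x, y]) (r s : k) :
    ∃ f : Module.Dual k C, f 1 = 0 ∧ f x = r ∧ f y = s := by
  obtain ⟨g, hg⟩ := exists_dual_apply_eq hli ![r, s]
  refine ⟨g - g 1 • Coalgebra.counit (R := k), by simp, ?_, ?_⟩
  · simpa [counit_of_isPrimitiveElt hx] using hg 0
  · simpa [counit_of_isPrimitiveElt hy] using hg 1

theorem exists_thinTriple (hP : Module.finrank k (primitiveSubmodule k C) = 2)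
    (hgk : 2 < gkDim k C) (hx : IsPrimitiveElt k x) (hy : IsPrimitiveElt k y)
    (hz : Coalgebra.comul (R := k) z = 1 ⊗ₜ[k] z + x ⊗ₜ[k] y - y ⊗ₜ[k] x + z ⊗ₜ[k] 1)
    (hgen : Algebra.adjoin k {x, y, z} = ⊤) : ∃ ξ η, ThinTriple k x y z ξ η := by
  have hli := linearIndependent_of_two_lt_gkDim hP hgk hx hy hz hgen
  have hspan := eq_span_pair_of_finrank_eq_two hP hx hy hli
  have mem_span {p : C} (hp : IsPrimitiveElt k p) : p ∈ Submodule.span k {x, y} := hspan ▸ hp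
  have mem_thinFil {p : C} (hp : IsPrimitiveElt k p) : p ∈ thinFil k x y z 1 := by
    obtain ⟨a, b, rfl⟩ := Submodule.mem_span_pair.1 (mem_span hp)
    exact add_mem (Submodule.smul_mem _ _ x_mem_thinFil) (Submodule.smul_mem _ _ y_mem_thinFil)
  have lie_z_mem {p : C} (hp : IsPrimitiveElt k p) : ⁅p, z⁆ ∈ thinFil k x y z 2 := by
    obtain ⟨a, b, hab⟩ := Submodule.mem_span_pair.1 (mem_span (isPrimitiveElt_lie hp hx))
    obtain ⟨c, d, hcd⟩ := Submodule.mem_span_pair.1 (mem_span (isPrimitiveElt_lie hp hy))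
    have h := mem_thinFil (isPrimitiveElt_lie_sub_smul hz hp hab.symm hcd.symm)
    exact (Submodule.sub_mem_iff_left _ (Submodule.smul_mem _ _ z_mem_thinFil)).1
      (monotone_thinFil one_le_two h)
  obtain ⟨ξ, ξ_one, ξ_x, ξ_y⟩ := exists_dual_of_isPrimitiveElt hx hy hli 1 0
  obtain ⟨η, η_one, η_x, η_y⟩ := exists_dual_of_isPrimitiveElt hx hy hli 0 1
  exact ⟨ξ, η, hx, hy, hz, mem_thinFil (isPrimitiveElt_lie hx hy), lie_z_mem hx, lie_z_mem hy, hgen,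
    ξ_one, ξ_x, ξ_y, η_one, η_x, η_y⟩

end PrimitivelyThin

end ThinHopf

end

theorem proposition4p10 {k C : Type*} [Field k] [CharZero k] [Ring C] [HopfAlgebra k C]
    (hthin : IsPrimitivelyThin k C) (hgk : gkDim k C = 3)
    (x y z : C) (hx : IsPrimitiveElt k x) (hy : IsPrimitiveElt k y)
    (hz : Coalgebra.comul (R := k) z =
      1 ⊗ₜ[k] z + x ⊗ₜ[k] y - y ⊗ₜ[k] x + z ⊗ₜ[k] 1)
    (hgen : Algebra.adjoin k {x, y, z} = ⊤) :
    ∃ (hu : cobarU k x y z ∈ cobarCocycles k C 2)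
      (ht : cobarT k x y z ∈ cobarCocycles k C 2),
      Submodule.span k {cobarClass k (cobarU k x y z) hu, cobarClass k (cobarT k x y z) ht} = ⊤ ∧
      Module.finrank k (CobarCohomology k C 2) = 2 := by
  have h23 : (2 : EReal) < 3 := by exact_mod_cast (by norm_num : (2 : ℝ) < 3)
  obtain ⟨ξ, η, T⟩ :=
    ThinHopf.exists_thinTriple hthin.finrank_primitive (hgk ▸ h23) hx hy hz hgen
  have hu := ThinHopf.cobarU_mem_cobarCocycles hx hy hz
  have ht := ThinHopf.cobarT_mem_cobarCocycles hx hy hz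
  have hspan := ThinHopf.span_cobarClass_pair_eq_top hu ht T.cobarCocycles_le_span_sup
  have hli := ThinHopf.linearIndependent_cobarClass_pair hu ht
    fun _ _ => T.eq_zero_of_smul_add_smul_mem_cobarCoboundaries
  exact ⟨hu, ht, hspan, ThinHopf.finrank_eq_two_of_span_pair_eq_top hli hspan⟩
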